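/- Let $\Gamma(1)=\mathrm{PSL}_2(\mathbb Z)$ with generators $S=\pm\begin{pmatrix}0&1\\-1&0\end{pmatrix}$ and $T=\pm\begin{pmatrix}1&1\\0&1\end{pmatrix}$. Let $\Gamma\subset\Gamma(1)$ be a torsion-free normal subgroup of finite index, and let $\Gamma_{\mathrm{par}}$ be the subgroup generated by all parabolic elements of $\Gamma$. Let $q\ge 0$ be an integer and let $(\eta,V_\eta)$ be a finite-dimensional complex representation of $\Gamma(1)$ whose restriction to $\Gamma$ is trivial on $\Gamma_{\mathrm{par}}$ and unipotent of length $q$; that is, there is a $\Gamma$-stable filtration $0\subset V_{\eta,0}\subset\dots\subset V_{\eta,q}=V_\eta$ such that $\Gamma$ acts trivially on $V_{\eta,0}$ and on each quotient $V_{\eta,k}/V_{\eta,k-1}$, $1\le k\le q$. Let $\nu\in\mathbb C$ with $\mathrm{Re}(\nu)>-\tfrac12$. Complex powers are taken with the principal branch of the logarithm on $\mathbb C\smallsetminus(-\infty,0]$. Let $\Psi_{\nu,\eta}$ be the space of holomorphic functions $\psi:\mathbb C\smallsetminus(-\infty,0]\to V_\eta$ satisfying the Lewis equation $$\eta(T)\psi(z)=\psi(z+1)+(z+1)^{-2\nu-1}\,\eta(ST^{-1})\,\psi\!\left(\frac{z}{z+1}\right)$$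 and the asymptotic formula $$0=e^{\pi i\nu}\lim_{\mathrm{Im}(z)\to\infty}\Big(\psi(z)+z^{-2\nu-1}\eta(S)\psi\big(\tfrac{-1}{z}\big)\Big)+e^{-\pi i\nu}\lim_{\mathrm{Im}(z)\to-\infty}\Big(\psi(z)+z^{-2\nu-1}\eta(S)\psi\big(\tfrac{-1}{z}\big)\Big),$$ where both limits are required to exist. Let $\Psi^o_{\nu,\eta}$, the space of period functions, be the set of all $\psi\in\Psi_{\nu,\eta}$ for which there is some $C$ with $0<C<2\,\mathrm{Re}(\nu)+1$ such that $$\psi(z)=O\big(\min\{1,|z|^{-C}\}\big)\qquad (z\in\mathbb C\smallsetminus(-\infty,0]),$$ uniformly on every closed subsector $|\arg z|\le\pi-\delta$, $\delta>0$ (the implied constant may depend on $\delta$, while $C$ may not). Put $\kappa_\nu=-\min(0,2\,\mathrm{Re}(\nu))$ and let $\Psi^{\mathbb R}_{\nu,\eta}$ be the space of real-analytic functions $\psi:(0,\infty)\to V_\eta$ such that $$\eta(T)\psi(x)=\psi(x+1)+(x+1)^{-2\nu-1}\,\eta(ST^{-1})\,\psi\!\left(\frac{x}{x+1}\right)\qquad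 (x>0),$$ $$\psi(x)=o\big(x^{-1+\kappa_\nu}\big)\quad (x\to 0^+),\qquad\qquad \psi(x)=o(1)\quad (x\to+\infty).$$ **Theorem.** For $\mathrm{Re}(\nu)>-\tfrac12$ one has $$\Psi^{\mathbb R}_{\nu,\eta}=\{\psi|_{(0,\infty)}:\psi\in\Psi^o_{\nu,\eta}\}.$$ -/

import Mathlib

open Filter Topology Asymptotics

namespace LewisZagier

/-- The full modular group `PSL₂(ℤ)`. -/
abbrev ModGroup : Type := Matrix.ProjectiveSpecialLinearGroup (Fin 2) ℤ

/-- The class in `PSL₂(ℤ)` of a matrix in `SL₂(ℤ)`. -/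
def toMod (g : Matrix.SpecialLinearGroup (Fin 2) ℤ) : ModGroup := QuotientGroup.mk g

/-- The matrix `(0 1; -1 0)`. -/
def matS : Matrix.SpecialLinearGroup (Fin 2) ℤ :=
  ⟨!![0, 1; -1, 0], by simp [Matrix.det_fin_two]⟩

/-- The matrix `(1 1; 0 1)`. -/
def matT : Matrix.SpecialLinearGroup (Fin 2) ℤ :=
  ⟨!![1, 1; 0, 1], by simp [Matrix.det_fin_two]⟩

/-- The generator `S = ±(0 1; -1 0)`. -/
def genS : ModGroup := toMod matS

/-- The generator `T = ±(1 1; 0 1)`. -/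
def genT : ModGroup := toMod matT

/-- An element of `PSL₂(ℤ)` is parabolic if it is represented by a parabolic matrix, i.e. by a
non-scalar matrix whose characteristic polynomial has discriminant zero. -/
def IsParabolicElt (γ : ModGroup) : Prop :=
  ∃ g : Matrix.SpecialLinearGroup (Fin 2) ℤ, toMod g = γ ∧
    (g : Matrix (Fin 2) (Fin 2) ℤ).IsParabolic

/-- The subgroup `Γ_par` of `Γ` generated by the parabolic elements of `Γ`. -/
def parabolicSubgroup (Γ : Subgroup ModGroup) : Subgroup ModGroup :=
  Subgroup.closure {γ | γ ∈ Γ ∧ IsParabolicElt γ}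

/-- `Γ` has no elements of finite order apart from the identity. -/
def IsTorsionFreeSubgroup (Γ : Subgroup ModGroup) : Prop :=
  ∀ γ ∈ Γ, ∀ n : ℕ, 0 < n → γ ^ n = 1 → γ = 1

section Spaces

variable {V : Type*} [NormedAddCommGroup V] [NormedSpace ℂ V]

/-- The restriction of `η` to the subgroup `P` is the trivial representation. -/
def IsTrivialOn (P : Subgroup ModGroup) (η : Representation ℂ ModGroup V) : Prop :=
  ∀ γ ∈ P, ∀ v : V, η γ v = v

/-- The restriction of `η` to `Γ` is unipotent of length `q`: there is a `Γ`-stable filtration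
`0 ⊆ F 0 ⊆ F 1 ⊆ ⋯ ⊆ F q = V` with trivial action of `Γ` on `F 0` and on every quotient
`F (k + 1) / F k`. -/
def IsUnipotentOn (Γ : Subgroup ModGroup) (q : ℕ) (η : Representation ℂ ModGroup V) : Prop :=
  ∃ F : ℕ → Submodule ℂ V,
    F q = ⊤ ∧
    (∀ k < q, F k ≤ F (k + 1)) ∧
    (∀ k ≤ q, ∀ γ ∈ Γ, ∀ v ∈ F k, η γ v ∈ F k) ∧
    (∀ γ ∈ Γ, ∀ v ∈ F 0, η γ v = v) ∧
    (∀ k < q, ∀ γ ∈ Γ, ∀ v ∈ F (k + 1), η γ v - v ∈ F k)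

/-- The expression `ψ(z) + z^{-2ν-1} η(S) ψ(-1/z)`. -/
noncomputable def symmetrized (ν : ℂ) (η : Representation ℂ ModGroup V) (ψ : ℂ → V) (z : ℂ) : V :=
  ψ z + z ^ (-2 * ν - 1) • η genS (ψ (-1 / z))

/-- `ψ` is holomorphic on `ℂ ∖ (-∞, 0]` and satisfies there the Lewis equation, and the two limits
of `ψ(z) + z^{-2ν-1} η(S) ψ(-1/z)` as `Im z → ±∞` exist and satisfy the asymptotic formula.
Only the values of `ψ` on `ℂ ∖ (-∞, 0]` matter. -/
structure IsLewisFunction (ν : ℂ) (η : Representation ℂ ModGroup V) (ψ : ℂ → V) : Prop where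
  holomorphic : DifferentiableOn ℂ ψ Complex.slitPlane
  lewis : ∀ z ∈ Complex.slitPlane,
    η genT (ψ z) =
      ψ (z + 1) + (z + 1) ^ (-2 * ν - 1) • η (genS * genT⁻¹) (ψ (z / (z + 1)))
  limits : ∃ a b : V,
    Tendsto (symmetrized ν η ψ) (comap Complex.im atTop) (𝓝 a) ∧
    Tendsto (symmetrized ν η ψ) (comap Complex.im atBot) (𝓝 b) ∧
    0 = Complex.exp (Real.pi * Complex.I * ν) • a + Complex.exp (-(Real.pi * Complex.I * ν)) • b

/-- `ψ(z) = O(min {1, |z|^{-C}})` on `ℂ ∖ (-∞, 0]`, uniformly on each closed subsector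
`|arg z| ≤ π - δ`, `δ > 0`. -/
def HasSlitPlaneBound (C : ℝ) (ψ : ℂ → V) : Prop :=
  ∀ δ : ℝ, 0 < δ → ∃ K : ℝ, ∀ z ∈ Complex.slitPlane, |z.arg| ≤ Real.pi - δ →
    ‖ψ z‖ ≤ K * min 1 (‖z‖ ^ (-C))

/-- The space `Ψ^o_{ν,η}` of period functions, as a set of functions on `ℂ ∖ (-∞, 0]`. -/
def periodSpace (ν : ℂ) (η : Representation ℂ ModGroup V) : Set (Complex.slitPlane → V) :=
  {f | ∃ ψ : ℂ → V, IsLewisFunction ν η ψ ∧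
    (∃ C : ℝ, 0 < C ∧ C < 2 * ν.re + 1 ∧ HasSlitPlaneBound C ψ) ∧
    Complex.slitPlane.domRestrict ψ = f}

/-- The number `κ_ν = -min(0, 2 Re ν)`. -/
noncomputable def kappa (ν : ℂ) : ℝ := -min 0 (2 * ν.re)

/-- `ψ` is real analytic on `(0, ∞)`, satisfies there the real Lewis equation, and
`ψ(x) = o(x^{-1+κ_ν})` as `x → 0+`, `ψ(x) = o(1)` as `x → ∞`. Only the values of `ψ` on `(0, ∞)`
matter. -/
structure IsRealPeriodFunction (ν : ℂ) (η : Representation ℂ ModGroup V) (ψ : ℝ → V) : Prop where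
  analytic : AnalyticOnNhd ℝ ψ (Set.Ioi 0)
  lewis : ∀ x : ℝ, 0 < x →
    η genT (ψ x) =
      ψ (x + 1) + ((x : ℂ) + 1) ^ (-2 * ν - 1) • η (genS * genT⁻¹) (ψ (x / (x + 1)))
  at_zero : ψ =o[𝓝[>] 0] fun x : ℝ => x ^ (-1 + kappa ν)
  at_infty : ψ =o[atTop] fun _ : ℝ => (1 : ℝ)

/-- The space `Ψ^ℝ_{ν,η}`, as a set of functions on `(0, ∞)`. -/
def realPeriodSpace (ν : ℂ) (η : Representation ℂ ModGroup V) : Set (Set.Ioi (0 : ℝ) → V) :=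
  {f | ∃ ψ : ℝ → V, IsRealPeriodFunction ν η ψ ∧ (Set.Ioi (0 : ℝ)).domRestrict ψ = f}

/-- Restriction of functions from `ℂ ∖ (-∞, 0]` to `(0, ∞)`. -/
def restrictToPosReals (f : Complex.slitPlane → V) : Set.Ioi (0 : ℝ) → V :=
  fun x => f ⟨(x : ℝ), Complex.ofReal_mem_slitPlane.2 x.2⟩

end Spaces

end LewisZagier

/-!
Write `p = -2ν - 1`, so that `Re p < 0`. Solved for `ψ(z)`, the Lewis equation is the three-term
equation `ψ(z) = A ψ(z+1) + (z+1)^p B ψ(z/(z+1))` with `A = η(T⁻¹)` and `B = η(S T S⁻¹)`. Some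
power `T ^ N`, `N ≥ 1`, is a parabolic element of `Γ`, hence `A ^ N = B ^ N = 1`; this is all that
is used about the representation.

Restricting a period function to `(0, ∞)` obviously gives a real period function. Conversely, let
`ψ` be a real period function.

* Iterating the equation in the direction `x ↦ x + 1` gives
  `ψ(x) = ∑ A ^ k (x+k+1)^p B ψ(1 - 1/(x+k+1))`, which only involves `ψ` near `1`, where it extends
  holomorphically. In blocks of `N` terms the sum converges absolutely if `Re p < -1`, and also if
  `(∑_{j<N} A ^ j) B ψ(1) = 0`; the latter is forced by the growth `ψ(x) = o(x^(1 + Re p))`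
  (`coinvariant_part_eq_zero`). So `ψ` extends to `{Re z > R} ∪ {|Im z| > R}`, with a power decay
  in sectors (`exists_extension_at_infty`).
* The inversion `φ(x) = x^p ψ(1/x)` solves the equation with `A` and `B` exchanged, and the growth
  condition on `ψ` at `0` is the one needed for `φ` at infinity. This gives the extension near `0`,
  with the bound `O(1)`.
* These extensions and the local ones at positive reals glue to a holomorphic function on a cone
  `|Im z| < κ Re z` (`exists_extension_cone`). As every point of the slit plane is moved into the
  cone by all sufficiently long words in `z ↦ z + 1` and `z ↦ z / (z + 1)`, the three-term equation
  itself defines the extension to the slit plane (`exists_extension_slitPlane`).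
* The bounds at `0` and infinity carry over by the identity theorem (`sector_bound`). They imply
  that both limits in the asymptotic formula are `0`: by the Lewis equation the function
  `ψ(z) + z^p η(S) ψ(-1/z)` is `N`-periodic, so only a vertical strip matters
  (`tendsto_symmetrized`).
-/

namespace LewisZagier

/-! ### Holomorphic functions and their restrictions to the real line -/

section Prelim

variable {V : Type*} [NormedAddCommGroup V] [NormedSpace ℂ V]

/-- Identity theorem: holomorphic functions on a connected open set meeting the real line are
determined by their values at real points. -/
lemma eqOn_of_eq_ofReal [CompleteSpace V] {U : Set ℂ} (hU : IsOpen U) (hc : IsPreconnected U)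
    {f g : ℂ → V} (hf : DifferentiableOn ℂ f U) (hg : DifferentiableOn ℂ g U) {x₀ : ℝ}
    (hx₀ : (x₀ : ℂ) ∈ U) (h : ∀ x : ℝ, (x : ℂ) ∈ U → f x = g x) : Set.EqOn f g U := by
  refine (hf.analyticOnNhd hU).eqOn_of_preconnected_of_frequently_eq (hg.analyticOnNhd hU) hc
    hx₀ ?_
  have h1 : Tendsto (fun x : ℝ => (x : ℂ)) (𝓝[≠] x₀) (𝓝[≠] (x₀ : ℂ)) := by
    refine tendsto_nhdsWithin_iff.2 ⟨?_, ?_⟩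
    · exact (Complex.continuous_ofReal.tendsto x₀).mono_left nhdsWithin_le_nhds
    · filter_upwards [self_mem_nhdsWithin] with x hx
      simpa using hx
  have h2 : ∀ᶠ x : ℝ in 𝓝[≠] x₀, f (x : ℂ) = g (x : ℂ) := by
    have : ∀ᶠ x : ℝ in 𝓝 x₀, (x : ℂ) ∈ U :=
      Complex.continuous_ofReal.continuousAt.eventually (hU.mem_nhds hx₀)
    filter_upwards [nhdsWithin_le_nhds this] with x hx using h x hx
  exact h1.frequently h2.frequently

/-- Gluing of a compatible family of holomorphic functions. -/
lemma exists_glue {ι : Type*} (U : ι → Set ℂ) (hU : ∀ i, IsOpen (U i)) (f : ι → ℂ → V)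
    (hf : ∀ i, DifferentiableOn ℂ (f i) (U i))
    (hfg : ∀ i j, ∀ z ∈ U i ∩ U j, f i z = f j z) :
    ∃ F : ℂ → V, DifferentiableOn ℂ F (⋃ i, U i) ∧ ∀ i, Set.EqOn F (f i) (U i) := by
  classical
  let F : ℂ → V := fun z => if h : ∃ i, z ∈ U i then f h.choose z else 0
  have hF : ∀ i, Set.EqOn F (f i) (U i) := by
    intro i z hz
    have h : ∃ i, z ∈ U i := ⟨i, hz⟩
    exact (dif_pos h : F z = f h.choose z).trans (hfg _ _ z ⟨h.choose_spec, hz⟩)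
  refine ⟨F, ?_, hF⟩
  intro z hz
  obtain ⟨i, hi⟩ := Set.mem_iUnion.1 hz
  have h1 : DifferentiableAt ℂ (f i) z := (hf i).differentiableAt ((hU i).mem_nhds hi)
  refine DifferentiableAt.differentiableWithinAt ?_
  exact h1.congr_of_eventuallyEq ((hF i).eventuallyEq_of_mem ((hU i).mem_nhds hi))

/-- A real analytic function extends holomorphically to a complex disc around each point. -/
lemma exists_holomorphic_extension [CompleteSpace V] {ψ : ℝ → V} {x : ℝ}
    (h : AnalyticAt ℝ ψ x) :
    ∃ r > 0, ∃ g : ℂ → V, DifferentiableOn ℂ g (Metric.ball (x : ℂ) r) ∧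
      ∀ y : ℝ, (y : ℂ) ∈ Metric.ball (x : ℂ) r → g y = ψ y := by
  obtain ⟨P, R, hP⟩ := h
  obtain ⟨r, hr0, hrR⟩ := ENNReal.lt_iff_exists_nnreal_btwn.1 hP.r_pos
  have hr : (0 : ℝ) < r := by exact_mod_cast hr0
  have hsum := P.summable_norm_mul_pow (hrR.trans_le hP.r_le)
  have hcoeff : ∀ n, ‖P.coeff n‖ ≤ ‖P n‖ := by
    intro n
    exact ((P n).le_opNorm (fun _ => 1)).trans (by simp)
  refine ⟨r, hr, fun z => ∑' n : ℕ, (z - x) ^ n • P.coeff n, ?_, ?_⟩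
  · refine Complex.differentiableOn_tsum_of_summable_norm hsum (fun n => ?_) Metric.isOpen_ball
      (fun n w hw => ?_)
    · fun_prop
    · rw [norm_smul, norm_pow, mul_comm]
      have hw' : ‖w - x‖ ≤ r := by
        have := Metric.mem_ball.1 hw
        rw [dist_eq_norm] at this
        exact this.le
      gcongr
      exact hcoeff n
  · intro y hy
    have hy' : y ∈ Metric.eball x R := by
      refine Metric.mem_eball.2 (lt_of_lt_of_le ?_ hrR.le)
      rw [Metric.mem_ball, dist_eq_norm, ← Complex.ofReal_sub, Complex.norm_real,
        ← dist_eq_norm] at hy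
      rw [edist_dist]
      exact (ENNReal.ofReal_lt_iff_lt_toReal dist_nonneg ENNReal.coe_ne_top).2 (by simpa using hy)
    have := hP.hasSum_sub hy'
    rw [← this.tsum_eq]
    refine tsum_congr fun n => ?_
    rw [FormalMultilinearSeries.apply_eq_pow_smul_coeff, ← Complex.ofReal_sub,
      ← Complex.ofReal_pow]
    exact Complex.coe_smul _ _

end Prelim

/-! ### Estimates for complex powers and for the zeta sum -/

lemma norm_cpow_le_rpow {z : ℂ} (p : ℂ) :
    ‖z ^ p‖ ≤ Real.exp (Real.pi * |p.im|) * ‖z‖ ^ p.re := by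
  refine (Complex.norm_cpow_le z p).trans ?_
  rw [div_eq_mul_inv, ← Real.exp_neg, mul_comm]
  gcongr
  calc -(z.arg * p.im) ≤ |z.arg * p.im| := neg_le_abs _
    _ = |z.arg| * |p.im| := abs_mul _ _
    _ ≤ Real.pi * |p.im| := by gcongr; exact Complex.abs_arg_le_pi z

lemma add_ofReal_mem_slitPlane {z : ℂ} (hz : z ∈ Complex.slitPlane) {t : ℝ} (ht : 0 ≤ t) :
    z + t ∈ Complex.slitPlane := by
  rw [Complex.mem_slitPlane_iff] at hz ⊢
  rcases hz with h | h
  · left; simp; linarith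
  · right; simpa using h

/-- Mean value estimate for complex powers along a horizontal segment. -/
lemma norm_cpow_add_sub_le {p z : ℂ} (hp : p.re ≤ 1) (hz : z ∈ Complex.slitPlane) {t ρ : ℝ}
    (ht : 0 ≤ t) (hρ : 0 < ρ) (h : ∀ θ ∈ Set.Icc 0 t, ρ ≤ ‖z + (θ : ℝ)‖) :
    ‖(z + t) ^ p - z ^ p‖ ≤
      ‖p‖ * Real.exp (Real.pi * |p.im|) * ρ ^ (p.re - 1) * t := by
  have key := Convex.norm_image_sub_le_of_norm_hasDerivWithin_le
    (f := fun θ : ℝ => (z + θ) ^ p) (f' := fun θ : ℝ => p * (z + θ) ^ (p - 1))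
    (s := Set.Icc 0 t) (x := 0) (y := t)
    (C := ‖p‖ * Real.exp (Real.pi * |p.im|) * ρ ^ (p.re - 1)) ?_ ?_ (convex_Icc 0 t)
    ⟨le_rfl, ht⟩ ⟨ht, le_rfl⟩
  · simpa [abs_of_nonneg ht] using key
  · intro θ hθ
    have h1 : HasDerivAt (fun θ : ℝ => z + (θ : ℂ)) 1 θ :=
      (Complex.ofRealCLM.hasDerivAt (x := θ)).const_add z |>.congr_deriv (by simp)
    have h2 : HasDerivAt (fun y : ℂ => y ^ p) (p * (z + θ) ^ (p - 1)) (z + θ) := by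
      simpa using (hasDerivAt_id (z + (θ : ℂ))).cpow_const (c := p)
        (add_ofReal_mem_slitPlane hz hθ.1)
    exact ((h2.comp θ h1).congr_deriv (mul_one _)).hasDerivWithinAt
  · intro θ hθ
    rw [norm_mul, mul_assoc]
    refine mul_le_mul_of_nonneg_left ?_ (norm_nonneg _)
    refine (norm_cpow_le_rpow _).trans ?_
    simp only [Complex.sub_im, Complex.one_im, sub_zero, Complex.sub_re, Complex.one_re]
    refine mul_le_mul_of_nonneg_left ?_ (Real.exp_pos _).le
    exact Real.rpow_le_rpow_of_nonpos hρ (h θ hθ) (by linarith)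

/-- Comparison of a summand with a telescoping difference (the integral of `x ^ (-1 - τ)`). -/
lemma rpow_neg_sub_le {y τ : ℝ} (hy : 1 < y) (hτ : 0 < τ) :
    y ^ (-1 - τ) ≤ τ⁻¹ * ((y - 1) ^ (-τ) - y ^ (-τ)) := by
  have hy0 : 0 < y := by linarith
  have hu : 0 < 1 - 1 / y := by
    rw [sub_pos, div_lt_one hy0]; exact hy
  have h1 : 1 + τ / y ≤ (1 - 1 / y) ^ (-τ) := by
    rw [Real.rpow_def_of_pos hu]
    have h2 := Real.log_le_sub_one_of_pos hu
    have h3 : τ / y ≤ Real.log (1 - 1 / y) * -τ := by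
      have : τ * Real.log (1 - 1 / y) ≤ τ * (1 - 1 / y - 1) := by gcongr
      have e : τ * (1 - 1 / y - 1) = - (τ / y) := by ring
      linarith
    have h4 := Real.add_one_le_exp (Real.log (1 - 1 / y) * -τ)
    linarith
  have h2 : (y - 1) ^ (-τ) = y ^ (-τ) * (1 - 1 / y) ^ (-τ) := by
    rw [← Real.mul_rpow hy0.le hu.le]
    congr 1; field_simp
  have h3 : y ^ (-1 - τ) = y ^ (-τ) / y := by
    rw [show -1 - τ = -τ - 1 by ring, Real.rpow_sub_one hy0.ne']
  rw [h2, h3, ← div_eq_inv_mul, le_div_iff₀ hτ]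
  have h5 : 0 < y ^ (-τ) := Real.rpow_pos_of_pos hy0 _
  have := mul_le_mul_of_nonneg_left h1 h5.le
  have e : y ^ (-τ) * (1 + τ / y) = y ^ (-τ) + y ^ (-τ) / y * τ := by ring
  linarith

lemma sum_rpow_le {a τ : ℝ} (ha : 1 ≤ a) (hτ : 0 < τ) (n : ℕ) :
    ∑ m ∈ Finset.range n, (a + m) ^ (-1 - τ) ≤ (1 + τ⁻¹) * a ^ (-τ) := by
  have key : ∀ n : ℕ, ∑ m ∈ Finset.range (n + 1), (a + m) ^ (-1 - τ) ≤
      (1 + τ⁻¹) * a ^ (-τ) - τ⁻¹ * (a + n) ^ (-τ) := by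
    intro n
    induction n with
    | zero =>
      have : a ^ (-1 - τ) ≤ a ^ (-τ) := Real.rpow_le_rpow_of_exponent_le ha (by linarith)
      simp; linarith
    | succ k ih =>
      rw [Finset.sum_range_succ]
      have h := rpow_neg_sub_le (y := a + (k + 1 : ℕ)) (τ := τ)
        (by push_cast; linarith [(Nat.cast_nonneg k : (0 : ℝ) ≤ k)]) hτ
      have e : a + ((k + 1 : ℕ) : ℝ) - 1 = a + k := by push_cast; ring
      rw [e, mul_sub] at h
      linarith
  rcases n with _ | n
  · simp; positivity
  · refine (key n).trans ?_
    have : 0 ≤ τ⁻¹ * (a + n) ^ (-τ) := by positivity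
    linarith

lemma summable_rpow_add {a τ : ℝ} (ha : 1 ≤ a) (hτ : 0 < τ) :
    Summable fun m : ℕ => (a + m) ^ (-1 - τ) :=
  summable_of_sum_range_le (fun m => by positivity) (sum_rpow_le ha hτ)

lemma tsum_rpow_le {a τ : ℝ} (ha : 1 ≤ a) (hτ : 0 < τ) :
    ∑' m : ℕ, (a + m) ^ (-1 - τ) ≤ (1 + τ⁻¹) * a ^ (-τ) :=
  Real.tsum_le_of_sum_range_le (fun m => by positivity) (sum_rpow_le ha hτ)

/-- In the sector `Re z ≥ -c ‖z‖` a shift to the right costs at most a constant factor. -/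
lemma sector_add_ge {c : ℝ} (hc0 : 0 ≤ c) (hc : c < 1) {z : ℂ}
    (hz : -c * ‖z‖ ≤ z.re) {t : ℝ} (ht : 0 ≤ t) :
    Real.sqrt ((1 - c) / 2) * (‖z‖ + t) ≤ ‖z + t‖ := by
  have h0 : 0 ≤ ‖z‖ := norm_nonneg z
  have hc1 : 0 ≤ (1 - c) / 2 := by linarith
  refine le_of_sq_le_sq ?_ (norm_nonneg _)
  rw [mul_pow, Real.sq_sqrt hc1]
  have e : ‖z + t‖ ^ 2 = ‖z‖ ^ 2 + t ^ 2 + 2 * t * z.re := by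
    rw [Complex.sq_norm, Complex.sq_norm, Complex.normSq_apply, Complex.normSq_apply]
    simp; ring
  rw [e]
  nlinarith [mul_le_mul_of_nonneg_left hz ht, mul_nonneg ht h0,
    mul_nonneg (by linarith : 0 ≤ 1 + c) (sq_nonneg (‖z‖ - t))]

/-! ### Sums of translates -/

/-- The complement of the half strip `Re z ≤ R`, `|Im z| ≤ R`. It is stable under `z ↦ z + t`,
`t ≥ 0`, and all its points have norm larger than `R`. -/
def rightDomain (R : ℝ) : Set ℂ := {z | R < z.re} ∪ {z | R < |z.im|}

lemma isOpen_rightDomain (R : ℝ) : IsOpen (rightDomain R) :=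
  (isOpen_lt continuous_const Complex.continuous_re).union
    (isOpen_lt continuous_const (continuous_abs.comp Complex.continuous_im))

lemma isPreconnected_rightDomain (R : ℝ) : IsPreconnected (rightDomain R) := by
  have e : rightDomain R = ({z | R < z.re} ∪ {z : ℂ | R < z.im}) ∪
      ({z | R < z.re} ∪ {z : ℂ | z.im < -R}) := by
    ext z
    simp only [rightDomain, Set.mem_union, Set.mem_ofPred_eq, lt_abs, lt_neg]
    tauto
  rw [e]
  have h1 : IsPreconnected {z : ℂ | R < z.re} := (convex_halfSpace_re_gt R).isPreconnected
  have h2 : ((R + 1 : ℝ) : ℂ) ∈ {z : ℂ | R < z.re} := by simp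
  refine IsPreconnected.union ((R + 1 : ℝ) : ℂ) (Or.inl h2) (Or.inl h2) ?_ ?_
  · exact IsPreconnected.union (⟨R + 1, R + 1⟩ : ℂ) (by simp) (by simp) h1
      (convex_halfSpace_im_gt R).isPreconnected
  · exact IsPreconnected.union (⟨R + 1, -R - 1⟩ : ℂ) (by simp) (by simp) h1
      (convex_halfSpace_im_lt (-R)).isPreconnected

lemma ofReal_mem_rightDomain {R x : ℝ} (h : R < x) : (x : ℂ) ∈ rightDomain R :=
  Or.inl (by simpa using h)

lemma lt_norm_of_mem_rightDomain {R : ℝ} {z : ℂ} (hz : z ∈ rightDomain R) : R < ‖z‖ := by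
  rcases hz with h | h
  · exact lt_of_lt_of_le h (Complex.re_le_norm z)
  · exact lt_of_lt_of_le h (Complex.abs_im_le_norm z)

lemma mem_slitPlane_of_mem_rightDomain {R : ℝ} (hR : 0 ≤ R) {z : ℂ} (hz : z ∈ rightDomain R) :
    z ∈ Complex.slitPlane := by
  rw [Complex.mem_slitPlane_iff]
  rcases hz with h | h
  · exact Or.inl (hR.trans_lt h)
  · exact Or.inr (abs_pos.1 (hR.trans_lt h))

lemma add_mem_rightDomain {R : ℝ} {z : ℂ} (hz : z ∈ rightDomain R) {t : ℝ} (ht : 0 ≤ t) :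
    z + t ∈ rightDomain R := by
  rcases hz with h | h
  · left; simp only [Set.mem_ofPred_eq, Complex.add_re, Complex.ofReal_re] at h ⊢; linarith
  · right; simpa using h

/-- Every point of the slit plane lies in an open sector `Re z > -c ‖z‖` with `c < 1`. -/
lemma exists_sector {z : ℂ} (hz : z ∈ Complex.slitPlane) :
    ∃ c, 0 ≤ c ∧ c < 1 ∧ -c * ‖z‖ < z.re := by
  by_cases h : z.im = 0
  · refine ⟨0, le_rfl, one_pos, ?_⟩
    rcases Complex.mem_slitPlane_iff.1 hz with h' | h'
    · simpa using h'
    · exact absurd h h'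
  · have h1 := Complex.abs_re_lt_norm.2 h
    have h0 : 0 < ‖z‖ := (abs_nonneg _).trans_lt h1
    have h2 : |z.re| / ‖z‖ < 1 := (div_lt_one h0).2 h1
    have h3 : 0 ≤ |z.re| / ‖z‖ := by positivity
    refine ⟨(|z.re| / ‖z‖ + 1) / 2, by linarith, by linarith, ?_⟩
    have h4 : |z.re| < (|z.re| / ‖z‖ + 1) / 2 * ‖z‖ := by
      have : |z.re| = |z.re| / ‖z‖ * ‖z‖ := by field_simp
      nlinarith
    linarith [neg_abs_le z.re]

section Translates

variable {V : Type*} [NormedAddCommGroup V] [NormedSpace ℂ V]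

/-- A function decaying faster than `‖z‖⁻¹` can be summed over the translates `z + m N`, and
the sum loses one power of `‖z‖` in each sector. -/
lemma exists_sum_translates [CompleteSpace V] {R : ℝ} (hR : 1 ≤ R) {N : ℕ} (hN : 1 ≤ N)
    {G : ℂ → V} (hG : DifferentiableOn ℂ G (rightDomain R)) {K τ : ℝ} (hK0 : 0 ≤ K) (hτ : 0 < τ)
    (hK : ∀ z ∈ rightDomain R, ‖G z‖ ≤ K * ‖z‖ ^ (-1 - τ)) :
    ∃ F : ℂ → V, DifferentiableOn ℂ F (rightDomain R) ∧
      (∀ z ∈ rightDomain R, HasSum (fun m : ℕ => G (z + ((m * N : ℕ) : ℝ))) (F z)) ∧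
      ∀ c, 0 ≤ c → c < 1 → ∃ K', ∀ z ∈ rightDomain R, -c * ‖z‖ ≤ z.re →
        ‖F z‖ ≤ K' * ‖z‖ ^ (-τ) := by
  have term : ∀ c, 0 ≤ c → c < 1 → ∀ z ∈ rightDomain R, -c * ‖z‖ ≤ z.re → ∀ m : ℕ,
      ‖G (z + ((m * N : ℕ) : ℝ))‖ ≤
        K * Real.sqrt ((1 - c) / 2) ^ (-1 - τ) * (‖z‖ + m) ^ (-1 - τ) := by
    intro c hc0 hc z hz hzc m
    have hs : 0 < Real.sqrt ((1 - c) / 2) := Real.sqrt_pos.2 (by linarith)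
    have hz0 : 0 < ‖z‖ := by linarith [lt_norm_of_mem_rightDomain hz]
    refine (hK _ (add_mem_rightDomain hz (Nat.cast_nonneg _))).trans ?_
    rw [mul_assoc, ← Real.mul_rpow hs.le (by positivity)]
    refine mul_le_mul_of_nonneg_left ?_ hK0
    refine Real.rpow_le_rpow_of_nonpos (by positivity) ?_ (by linarith)
    refine le_trans ?_ (sector_add_ge hc0 hc hzc (Nat.cast_nonneg (m * N)))
    have : (m : ℝ) ≤ ((m * N : ℕ) : ℝ) := by exact_mod_cast Nat.le_mul_of_pos_right m hN
    gcongr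
  have summ : ∀ c, 0 ≤ c → c < 1 → ∀ z ∈ rightDomain R, -c * ‖z‖ ≤ z.re →
      Summable fun m : ℕ => ‖G (z + ((m * N : ℕ) : ℝ))‖ := by
    intro c hc0 hc z hz hzc
    refine Summable.of_nonneg_of_le (fun _ => norm_nonneg _) (term c hc0 hc z hz hzc) ?_
    exact (summable_rpow_add (hR.trans (lt_norm_of_mem_rightDomain hz).le) hτ).mul_left _
  refine ⟨fun z => ∑' m : ℕ, G (z + ((m * N : ℕ) : ℝ)), ?_, ?_, ?_⟩
  · intro z₀ hz₀
    obtain ⟨c, hc0, hc, hz₀c⟩ :=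
      exists_sector (mem_slitPlane_of_mem_rightDomain (by linarith) hz₀)
    set U := rightDomain R ∩ {z : ℂ | -c * ‖z‖ < z.re} with hU
    have hUo : IsOpen U := (isOpen_rightDomain R).inter
      (isOpen_lt (by fun_prop) Complex.continuous_re)
    have hd : DifferentiableOn ℂ (fun z => ∑' m : ℕ, G (z + ((m * N : ℕ) : ℝ))) U := by
      refine Complex.differentiableOn_tsum_of_summable_norm
        (u := fun m : ℕ => K * Real.sqrt ((1 - c) / 2) ^ (-1 - τ) * (1 + m) ^ (-1 - τ))
        ((summable_rpow_add le_rfl hτ).mul_left _) (fun m => ?_) hUo (fun m z hz => ?_)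
      · refine hG.comp (by fun_prop) fun z hz => add_mem_rightDomain hz.1 (Nat.cast_nonneg _)
      · refine (term c hc0 hc z hz.1 (le_of_lt hz.2) m).trans ?_
        refine mul_le_mul_of_nonneg_left ?_ (by positivity)
        refine Real.rpow_le_rpow_of_nonpos (by positivity) ?_ (by linarith)
        linarith [lt_norm_of_mem_rightDomain hz.1]
    exact (hd.differentiableAt (hUo.mem_nhds ⟨hz₀, hz₀c⟩)).differentiableWithinAt
  · intro z hz
    obtain ⟨c, hc0, hc, hzc⟩ := exists_sector (mem_slitPlane_of_mem_rightDomain (by linarith) hz)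
    exact (summ c hc0 hc z hz hzc.le).of_norm.hasSum
  · intro c hc0 hc
    refine ⟨K * Real.sqrt ((1 - c) / 2) ^ (-1 - τ) * (1 + τ⁻¹), fun z hz hzc => ?_⟩
    have h1 : 1 ≤ ‖z‖ := hR.trans (lt_norm_of_mem_rightDomain hz).le
    refine (norm_tsum_le_tsum_norm (summ c hc0 hc z hz hzc)).trans ?_
    refine ((summ c hc0 hc z hz hzc).tsum_le_tsum (term c hc0 hc z hz hzc)
      ((summable_rpow_add h1 hτ).mul_left _)).trans ?_
    rw [tsum_mul_left, mul_assoc (K * _)]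
    exact mul_le_mul_of_nonneg_left (tsum_rpow_le h1 hτ) (by positivity)

end Translates

/-! ### Solutions of the three-term equation near infinity -/

section ThreeTerm

variable {V : Type*} [NormedAddCommGroup V] [NormedSpace ℂ V]

/-- The three-term equation `ψ(x) = A ψ(x+1) + (x+1)^p B ψ(x/(x+1))` on the positive reals: the
Lewis equation, solved for `ψ(x)`. -/
def IsThreeTerm (p : ℂ) (A B : V →L[ℂ] V) (ψ : ℝ → V) : Prop :=
  ∀ x : ℝ, 0 < x → ψ x = A (ψ (x + 1)) + ((x : ℂ) + 1) ^ p • B (ψ (x / (x + 1)))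

/-- If `ψ` is smaller than `x^(1 + Re p)` at infinity, then the `A`-coinvariant part of `B ψ(1)`
vanishes: otherwise the increments `x^p Q B ψ(1) + O(x^(Re p - 1))` of `Q ψ` would add up to
something of the order of `x^(1 + Re p)`. -/
lemma coinvariant_part_eq_zero {p : ℂ} (hp : p.re < 0) {A B Q : V →L[ℂ] V}
    (hQ : ∀ v, Q (A v) = Q v) {ψ : ℝ → V} (hψ : IsThreeTerm p A B ψ)
    (hd : DifferentiableAt ℝ ψ 1)
    (h0 : Tendsto (fun x : ℝ => x ^ (-p.re - 1) * ‖ψ x‖) atTop (𝓝 0)) : Q (B (ψ 1)) = 0 := by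
  set v := Q (B (ψ 1)) with hv
  set u : ℝ → V := fun x => Q (ψ x) with hu
  set E := ‖p‖ * Real.exp (Real.pi * |p.im|) with hE
  have hE0 : 0 ≤ E := by positivity
  obtain ⟨L, hL0, hL⟩ := hd.hasDerivAt.differentiableAt.isBigO_sub.exists_pos
  rw [isBigOWith_iff, Metric.eventually_nhds_iff] at hL
  obtain ⟨r, hr, hL⟩ := hL
  set C := ‖Q‖ * (‖B‖ * L) with hC
  -- the increments of `u`
  have inc : ∀ y : ℝ, 1 < y → 1 / r < y →
      ‖u (y - 1) - u y - (y : ℂ) ^ p • v‖ ≤ C * y ^ (p.re - 1) := by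
    intro y hy hyr
    have hy0 : 0 < y := by linarith
    have h1 := hψ (y - 1) (by linarith)
    have e1 : y - 1 + 1 = y := by ring
    have e2 : ((y - 1 : ℝ) : ℂ) + 1 = y := by push_cast; ring
    rw [e1, e2] at h1
    have h2 : u (y - 1) - u y - (y : ℂ) ^ p • v =
        (y : ℂ) ^ p • Q (B (ψ ((y - 1) / y) - ψ 1)) := by
      simp only [hu, hv, h1, map_add, map_smul, map_sub, hQ, smul_sub]
      abel
    have h3 : ‖ψ ((y - 1) / y) - ψ 1‖ ≤ L * (1 / y) := by
      have e3 : (y - 1) / y - 1 = - (1 / y) := by field_simp; ring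
      have hlt : dist ((y - 1) / y) 1 < r := by
        rw [Real.dist_eq, e3, abs_neg, abs_of_pos (by positivity)]
        rw [div_lt_iff₀ hr] at hyr
        rw [div_lt_iff₀ hy0]; linarith
      have := hL hlt
      rwa [e3, norm_neg, Real.norm_of_nonneg (by positivity)] at this
    rw [h2, norm_smul, Complex.norm_cpow_eq_rpow_re_of_pos hy0, Real.rpow_sub_one hy0.ne']
    have h4 : ‖Q (B (ψ ((y - 1) / y) - ψ 1))‖ ≤ C * (1 / y) := by
      calc _ ≤ ‖Q‖ * (‖B‖ * (L * (1 / y))) :=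
            (Q.le_opNorm _).trans (by gcongr; exact (B.le_opNorm _).trans (by gcongr))
        _ = C * (1 / y) := by rw [hC]; ring
    calc y ^ p.re * ‖Q (B (ψ ((y - 1) / y) - ψ 1))‖ ≤ y ^ p.re * (C * (1 / y)) := by gcongr
      _ = C * (y ^ p.re / y) := by ring
  -- on `[M m, M m + m]` the factor `x ^ p` is constant up to `E / M` in relative terms
  obtain ⟨M, hM⟩ := exists_nat_gt (2 * E + 1)
  have hM0 : (0 : ℝ) < M := by linarith
  -- summation of the increments over `[M m, M m + m]`
  have main : ∀ m : ℕ, 1 ≤ m → 1 / r < m →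
      (1 / 2) * (M : ℝ) ^ p.re * ‖v‖ ≤ (m : ℝ) ^ (-p.re - 1) * ‖u (M * m)‖ +
        (m : ℝ) ^ (-p.re - 1) * ‖u ((M + 1) * m)‖ + C * (M : ℝ) ^ (p.re - 1) * (1 / m) := by
    intro m hm1 hmr
    have hm : (1 : ℝ) ≤ m := by exact_mod_cast hm1
    have hm0 : (0 : ℝ) < m := by linarith
    set n : ℝ := M * m with hn
    have hn0 : 0 < n := by positivity
    have hmn : (m : ℝ) ≤ n := by rw [hn]; nlinarith
    have hterm : ∀ k ∈ Finset.range m,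
        ‖(u (n + k) - u (n + (k + 1 : ℕ))) - (n : ℂ) ^ p • v‖ ≤
          C * n ^ (p.re - 1) + E * n ^ (p.re - 1) * m * ‖v‖ := by
      intro k hk
      have hkm : ((k + 1 : ℕ) : ℝ) ≤ m := by exact_mod_cast Finset.mem_range.1 hk
      have hk1 : (0 : ℝ) < ((k + 1 : ℕ) : ℝ) := by positivity
      have h1 := inc (n + (k + 1 : ℕ)) (by linarith) (by linarith)
      have e1 : n + ((k + 1 : ℕ) : ℝ) - 1 = n + k := by push_cast; ring
      rw [e1] at h1
      have h2 := norm_cpow_add_sub_le (p := p) (z := n) (by linarith)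
        (Complex.ofReal_mem_slitPlane.2 hn0) hk1.le hn0 (fun θ hθ => by
          rw [← Complex.ofReal_add, Complex.norm_real, Real.norm_of_nonneg (by linarith [hθ.1])]
          linarith [hθ.1])
      have e2 : (u (n + k) - u (n + (k + 1 : ℕ))) - (n : ℂ) ^ p • v =
          (u (n + k) - u (n + (k + 1 : ℕ)) - ((n + (k + 1 : ℕ) : ℝ) : ℂ) ^ p • v) +
          (((n : ℂ) + ((k + 1 : ℕ) : ℝ)) ^ p - (n : ℂ) ^ p) • v := by
        push_cast; rw [sub_smul]; abel
      rw [e2]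
      refine (norm_add_le _ _).trans (add_le_add (h1.trans ?_) ?_)
      · gcongr C * ?_
        exact Real.rpow_le_rpow_of_nonpos hn0 (by linarith) (by linarith)
      · rw [norm_smul]
        refine mul_le_mul_of_nonneg_right (h2.trans ?_) (norm_nonneg _)
        gcongr
    have hsum := norm_sum_le_of_le _ hterm
    rw [Finset.sum_sub_distrib, Finset.sum_range_sub', Finset.sum_const, Finset.sum_const,
      Finset.card_range, nsmul_eq_mul, Nat.cast_zero, add_zero, ← Nat.cast_smul_eq_nsmul ℂ] at hsum
    have hlow : m * (n ^ p.re * ‖v‖) ≤ ‖u n‖ + ‖u (n + m)‖ +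
        m * (C * n ^ (p.re - 1) + E * n ^ (p.re - 1) * m * ‖v‖) := by
      have e : m * (n ^ p.re * ‖v‖) = ‖(m : ℂ) • ((n : ℂ) ^ p • v)‖ := by
        rw [norm_smul, norm_smul, Complex.norm_cpow_eq_rpow_re_of_pos hn0, Complex.norm_natCast]
      rw [e]
      have h1 := norm_sub_norm_le ((m : ℂ) • ((n : ℂ) ^ p • v)) (u n - u (n + m))
      rw [norm_sub_rev ((m : ℂ) • _) (u n - _)] at h1
      have h2 := norm_sub_le (u n) (u (n + m))
      linarith
    have hnp : n ^ p.re = (M : ℝ) ^ p.re * (m : ℝ) ^ p.re := Real.mul_rpow hM0.le hm0.le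
    have hnp1 : n ^ (p.re - 1) = (M : ℝ) ^ (p.re - 1) * (m : ℝ) ^ (p.re - 1) :=
      Real.mul_rpow hM0.le hm0.le
    have eM : (M : ℝ) ^ p.re = M * (M : ℝ) ^ (p.re - 1) := by
      rw [Real.rpow_sub_one hM0.ne']; field_simp
    have em : (m : ℝ) ^ p.re = m * (m : ℝ) ^ (p.re - 1) := by
      rw [Real.rpow_sub_one hm0.ne']; field_simp
    set a := (M : ℝ) ^ (p.re - 1)
    set b := (m : ℝ) ^ (p.re - 1) with hb
    have ha0 : 0 < a := by positivity
    have hb0 : 0 < b := by positivity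
    have hbinv : (m : ℝ) ^ (-p.re - 1) * (b * m * m) = 1 := by
      have : b * m * m = (m : ℝ) ^ (p.re + 1) := by
        rw [Real.rpow_add_one hm0.ne', em]; ring
      rw [this, ← Real.rpow_add hm0]; simp
    set d := (m : ℝ) ^ (-p.re - 1)
    have hd0 : 0 < d := by positivity
    have e3 : (M + 1 : ℝ) * m = n + m := by rw [hn]; ring
    rw [e3, eM]
    rw [hnp, hnp1, eM, em] at hlow
    have hfin := mul_le_mul_of_nonneg_left hlow hd0.le
    have eL : d * (m * (M * a * (m * b) * ‖v‖)) = M * a * ‖v‖ := by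
      linear_combination (M * a * ‖v‖) * hbinv
    have eR : d * (‖u n‖ + ‖u (n + m)‖ + m * (C * (a * b) + E * (a * b) * m * ‖v‖)) =
        d * ‖u n‖ + d * ‖u (n + m)‖ + C * a * (1 / m) + E * a * ‖v‖ := by
      have hdb : d * (m * b) = 1 / m := by
        field_simp; linear_combination hbinv
      linear_combination (E * a * ‖v‖) * hbinv + C * a * hdb
    rw [eL, eR] at hfin
    have : E * a * ‖v‖ ≤ (1 / 2) * (M * a) * ‖v‖ := by
      have := mul_nonneg ha0.le (norm_nonneg v)
      nlinarith
    linarith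
  have hlim : ∀ c : ℝ, 0 < c →
      Tendsto (fun m : ℕ => (m : ℝ) ^ (-p.re - 1) * ‖u (c * m)‖) atTop (𝓝 0) := by
    intro c hc
    have h1 : Tendsto (fun m : ℕ => c * (m : ℝ)) atTop atTop :=
      tendsto_natCast_atTop_atTop.const_mul_atTop hc
    have h2 := ((h0.comp h1).const_mul (‖Q‖ * c ^ (-(-p.re - 1))))
    rw [mul_zero] at h2
    refine squeeze_zero (fun m => by positivity) (fun m => ?_) h2
    simp only [Function.comp]
    rw [Real.mul_rpow hc.le (Nat.cast_nonneg m)]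
    have hcc : c ^ (-(-p.re - 1)) * c ^ (-p.re - 1) = 1 := by
      rw [← Real.rpow_add hc, neg_add_cancel, Real.rpow_zero]
    calc (m : ℝ) ^ (-p.re - 1) * ‖u (c * m)‖ ≤ (m : ℝ) ^ (-p.re - 1) * (‖Q‖ * ‖ψ (c * m)‖) := by
          gcongr; exact Q.le_opNorm _
      _ = _ := by linear_combination
                    -((m : ℝ) ^ (-p.re - 1) * (‖Q‖ * ‖ψ (c * m)‖)) * hcc
  have hR : Tendsto (fun m : ℕ => (m : ℝ) ^ (-p.re - 1) * ‖u (M * m)‖ +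
        (m : ℝ) ^ (-p.re - 1) * ‖u ((M + 1) * m)‖ + C * (M : ℝ) ^ (p.re - 1) * (1 / m))
        atTop (𝓝 0) := by
    have h3 := (tendsto_one_div_atTop_nhds_zero_nat (𝕜 := ℝ)).const_mul (C * (M : ℝ) ^ (p.re - 1))
    simpa using ((hlim M hM0).add (hlim (M + 1) (by positivity))).add h3
  have hle : (1 / 2) * (M : ℝ) ^ p.re * ‖v‖ ≤ 0 := by
    refine ge_of_tendsto hR ?_
    filter_upwards [eventually_ge_atTop 1,
      tendsto_natCast_atTop_atTop.eventually_gt_atTop (1 / r)] with m h1 h2 using main m h1 h2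
  have hMp : 0 < (1 / 2) * (M : ℝ) ^ p.re := by positivity
  have : ‖v‖ ≤ 0 := by
    by_contra hcon
    push Not at hcon
    linarith [mul_pos hMp hcon]
  exact norm_le_zero_iff.1 this

/-- The `n`-fold iteration of the three-term equation in the direction of `x ↦ x + 1`. -/
lemma IsThreeTerm.iterate {p : ℂ} {A B : V →L[ℂ] V} {ψ : ℝ → V} (hψ : IsThreeTerm p A B ψ)
    {x : ℝ} (hx : 0 < x) (n : ℕ) :
    ψ x = ∑ j ∈ Finset.range n, (A ^ j) (B (((x : ℂ) + (j + 1 : ℝ)) ^ p •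
      ψ (1 - 1 / (x + (j + 1))))) + (A ^ n) (ψ (x + n)) := by
  induction n with
  | zero => simp
  | succ k ih =>
    have hk : 0 < x + k := by positivity
    have h := hψ (x + k) hk
    have e1 : (x + k) / (x + k + 1) = 1 - 1 / (x + (k + 1)) := by
      have : x + (k + 1) ≠ 0 := by positivity
      rw [add_assoc]; field_simp; ring
    rw [Finset.sum_range_succ, add_assoc]
    refine ih.trans ?_
    congr 1
    rw [h, e1, map_add, pow_succ, mul_apply_eq_comp, add_comm]
    congr 1
    · rw [map_smul B]; push_cast; rw [add_assoc]
    · push_cast; rw [add_assoc]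

/-- A solution of the three-term equation which tends to `0` at infinity and is analytic at `1`
extends holomorphically to a domain `rightDomain R`: summing the equation over the translates
`x + k` expresses it through its values near `1`. Grouping `N` consecutive terms, where
`A ^ N = 1`, makes the sum absolutely convergent once the coinvariant part of `B ψ(1)` vanishes. -/
lemma exists_extension_at_infty [CompleteSpace V] {p : ℂ} (hp : p.re < 0) {A B : V →L[ℂ] V}
    {N : ℕ} (hN : 1 ≤ N) (hA : A ^ N = 1) {ψ : ℝ → V} (hψ : IsThreeTerm p A B ψ)
    (han : AnalyticAt ℝ ψ 1) (h0 : Tendsto ψ atTop (𝓝 0)) {τ : ℝ} (hτ0 : 0 < τ)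
    (hτ : τ = -p.re - 1 ∨ τ = -p.re ∧ (∑ j ∈ Finset.range N, A ^ j) (B (ψ 1)) = 0) :
    ∃ R, 1 ≤ R ∧ ∃ F : ℂ → V, DifferentiableOn ℂ F (rightDomain R) ∧
      (∀ x : ℝ, R < x → F x = ψ x) ∧
      ∀ c, 0 ≤ c → c < 1 → ∃ K, ∀ z ∈ rightDomain R, -c * ‖z‖ ≤ z.re →
        ‖F z‖ ≤ K * ‖z‖ ^ (-τ) := by
  obtain ⟨r₀, hr₀, g, hgd, hgψ⟩ := exists_holomorphic_extension han
  rw [Complex.ofReal_one] at hgd hgψ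
  have hg1 : g 1 = ψ 1 := by
    have := hgψ 1 (by simpa using hr₀)
    rwa [Complex.ofReal_one] at this
  obtain ⟨L, hL0, hL⟩ := ((hgd.differentiableAt
    (Metric.isOpen_ball.mem_nhds (Metric.mem_ball_self hr₀))).isBigO_sub).exists_pos
  rw [isBigOWith_iff, Metric.eventually_nhds_iff] at hL
  obtain ⟨r₁, hr₁, hL⟩ := hL
  set r := min r₀ r₁ with hr
  have hr0 : 0 < r := lt_min hr₀ hr₁
  set R : ℝ := max (max 1 (1 / r)) (2 * N) with hRdef
  have hR1 : 1 ≤ R := (le_max_left _ _).trans (le_max_left _ _)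
  have hRr : 1 / r ≤ R := (le_max_right _ _).trans (le_max_left _ _)
  have hRN : 2 * N ≤ R := le_max_right _ _
  have hR0 : 0 < R := by linarith
  have near : ∀ y ∈ rightDomain R, ‖1 / y‖ < r := by
    intro y hy
    have h1 := lt_norm_of_mem_rightDomain hy
    rw [norm_div, norm_one, div_lt_iff₀ (by linarith)]
    rw [div_le_iff₀ hr0] at hRr
    nlinarith
  have hdist : ∀ y ∈ rightDomain R, dist (1 - 1 / y) 1 < r := by
    intro y hy
    rw [dist_eq_norm, sub_sub_cancel_left, norm_neg]; exact near y hy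
  have hlip : ∀ y ∈ rightDomain R, ‖g (1 - 1 / y) - g 1‖ ≤ L * (1 / ‖y‖) := by
    intro y hy
    have := hL ((hdist y hy).trans_le (min_le_right _ _))
    rwa [sub_sub_cancel_left, norm_neg, norm_div, norm_one] at this
  have hball : ∀ y ∈ rightDomain R, 1 - 1 / y ∈ Metric.ball (1 : ℂ) r₀ := fun y hy =>
    (hdist y hy).trans_le (min_le_left _ _)
  set H : ℂ → V := fun y => y ^ p • g (1 - 1 / y) with hH
  have hHd : DifferentiableOn ℂ H (rightDomain R) := by
    refine DifferentiableOn.smul (fun y hy => ?_) (hgd.comp (fun y hy => ?_) hball)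
    · exact (differentiableAt_id.cpow_const
        (mem_slitPlane_of_mem_rightDomain hR0.le hy)).differentiableWithinAt
    · have hy0 : y ≠ 0 := norm_pos_iff.1 (hR0.trans (lt_norm_of_mem_rightDomain hy))
      exact ((differentiableAt_const _).sub ((differentiableAt_const _).div differentiableAt_id
        hy0)).differentiableWithinAt
  set G : ℂ → V := fun z => ∑ j ∈ Finset.range N, (A ^ j) (B (H (z + ((j : ℝ) + 1 : ℝ)))) with hG
  have hGd : DifferentiableOn ℂ G (rightDomain R) := by
    refine DifferentiableOn.fun_sum fun j _ => ?_
    refine (A ^ j).differentiable.comp_differentiableOn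
      (B.differentiable.comp_differentiableOn (hHd.comp (by fun_prop) fun z hz => ?_))
    exact add_mem_rightDomain hz (by positivity)
  set e := Real.exp (Real.pi * |p.im|) with he
  have he0 : 0 < e := Real.exp_pos _
  -- the points `z + θ`, `0 ≤ θ ≤ N`, are of the size of `z`
  have half : ∀ z ∈ rightDomain R, ∀ θ : ℝ, 0 ≤ θ → θ ≤ N → ‖z‖ / 2 ≤ ‖z + θ‖ := by
    intro z hz θ h0 h1
    have h2 := lt_norm_of_mem_rightDomain hz
    have h3 := norm_sub_le (z + θ) θ
    rw [add_sub_cancel_right, Complex.norm_real, Real.norm_of_nonneg h0] at h3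
    linarith
  have halfpow : ∀ z ∈ rightDomain R, ∀ θ : ℝ, 0 ≤ θ → θ ≤ N → ∀ s : ℝ, s ≤ 0 →
      ‖z + θ‖ ^ s ≤ (1 / 2) ^ s * ‖z‖ ^ s := by
    intro z hz θ h0 h1 s hs
    have hz0 : 0 < ‖z‖ := hR0.trans (lt_norm_of_mem_rightDomain hz)
    rw [← Real.mul_rpow (by norm_num) hz0.le]
    refine Real.rpow_le_rpow_of_nonpos (by positivity) ?_ hs
    have := half z hz θ h0 h1
    linarith
  have hGb : ∃ K, 0 ≤ K ∧ ∀ z ∈ rightDomain R, ‖G z‖ ≤ K * ‖z‖ ^ (-1 - τ) := by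
    -- terms `w z` which cancel in the block may be subtracted from `H`
    have block : ∀ (K₀ : ℝ) (w : ℂ → V), 0 ≤ K₀ →
        (∀ z, (∑ j ∈ Finset.range N, A ^ j) (B (w z)) = 0) →
        (∀ z ∈ rightDomain R, ∀ j < N, ‖H (z + ((j : ℝ) + 1 : ℝ)) - w z‖ ≤
          K₀ * ‖z‖ ^ (-1 - τ)) →
        ∃ K, 0 ≤ K ∧ ∀ z ∈ rightDomain R, ‖G z‖ ≤ K * ‖z‖ ^ (-1 - τ) := by
      intro K₀ w hK₀ hw hb
      refine ⟨(∑ j ∈ Finset.range N, ‖A ^ j‖ * ‖B‖) * K₀, by positivity, fun z hz => ?_⟩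
      have e1 : G z =
          ∑ j ∈ Finset.range N, (A ^ j) (B (H (z + ((j : ℝ) + 1 : ℝ)) - w z)) := by
        simp only [map_sub, Finset.sum_sub_distrib]
        have := hw z
        rw [_root_.sum_apply] at this
        rw [this, sub_zero]
      rw [e1, mul_assoc, Finset.sum_mul]
      refine norm_sum_le_of_le _ fun j hj => ?_
      refine ((A ^ j).le_opNorm _).trans ?_
      rw [mul_assoc]
      refine mul_le_mul_of_nonneg_left ((B.le_opNorm _).trans ?_) (norm_nonneg _)
      exact mul_le_mul_of_nonneg_left (hb z hz j (Finset.mem_range.1 hj)) (norm_nonneg _)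
    have hHsub : ∀ z ∈ rightDomain R, ∀ j < N,
        ‖(z + ((j : ℝ) + 1 : ℝ)) ^ p • (g (1 - 1 / (z + ((j : ℝ) + 1 : ℝ))) - g 1)‖ ≤
          e * L * (1 / 2) ^ (p.re - 1) * ‖z‖ ^ (p.re - 1) := by
      intro z hz j hj
      have hj' : (j : ℝ) + 1 ≤ N := by exact_mod_cast hj
      have hy := add_mem_rightDomain hz (t := (j : ℝ) + 1) (by positivity)
      set y := z + ((j : ℝ) + 1 : ℝ) with hydef
      have hy0 : 0 < ‖y‖ := hR0.trans (lt_norm_of_mem_rightDomain hy)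
      rw [norm_smul]
      calc ‖y ^ p‖ * ‖g (1 - 1 / y) - g 1‖ ≤ (e * ‖y‖ ^ p.re) * (L * (1 / ‖y‖)) := by
            gcongr
            · exact norm_cpow_le_rpow p
            · exact hlip y hy
        _ = e * L * ‖y‖ ^ (p.re - 1) := by rw [Real.rpow_sub_one hy0.ne']; ring
        _ ≤ e * L * ((1 / 2) ^ (p.re - 1) * ‖z‖ ^ (p.re - 1)) := by
            gcongr
            exact halfpow z hz _ (by positivity) hj' _ (by linarith)
        _ = _ := by ring
    rcases hτ with hτ | ⟨hτ, hQ⟩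
    · refine block (e * L * (1 / 2) ^ (p.re - 1) + e * (1 / 2) ^ p.re * ‖g 1‖) (fun _ => 0)
        (by positivity) (by simp) fun z hz j hj => ?_
      have hj' : (j : ℝ) + 1 ≤ N := by exact_mod_cast hj
      have hz1 : 1 ≤ ‖z‖ := hR1.trans (lt_norm_of_mem_rightDomain hz).le
      have e1 : H (z + ((j : ℝ) + 1 : ℝ)) - 0 =
          (z + ((j : ℝ) + 1 : ℝ)) ^ p • (g (1 - 1 / (z + ((j : ℝ) + 1 : ℝ))) - g 1) +
          (z + ((j : ℝ) + 1 : ℝ)) ^ p • g 1 := by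
        rw [smul_sub, sub_add_cancel, sub_zero]
      have e2 : -1 - τ = p.re := by rw [hτ]; ring
      rw [e1, e2, add_mul]
      refine (norm_add_le _ _).trans (add_le_add ((hHsub z hz j hj).trans ?_) ?_)
      · refine mul_le_mul_of_nonneg_left ?_ (by positivity)
        exact Real.rpow_le_rpow_of_exponent_le hz1 (by linarith)
      · rw [norm_smul]
        calc _ ≤ (e * ‖z + ((j : ℝ) + 1 : ℝ)‖ ^ p.re) * ‖g 1‖ := by
              gcongr; exact norm_cpow_le_rpow p
          _ ≤ (e * ((1 / 2) ^ p.re * ‖z‖ ^ p.re)) * ‖g 1‖ := by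
              gcongr; exact halfpow z hz _ (by positivity) hj' _ hp.le
          _ = _ := by ring
    · refine block (e * L * (1 / 2) ^ (p.re - 1) +
        ‖p‖ * e * (1 / 2) ^ (p.re - 1) * N * ‖g 1‖) (fun z => z ^ p • g 1)
        (by positivity) (fun z => by rw [map_smul, map_smul, hg1, hQ, smul_zero])
        fun z hz j hj => ?_
      have hj' : (j : ℝ) + 1 ≤ N := by exact_mod_cast hj
      have hz0 : 0 < ‖z‖ := hR0.trans (lt_norm_of_mem_rightDomain hz)
      have e1 : H (z + ((j : ℝ) + 1 : ℝ)) - z ^ p • g 1 =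
          (z + ((j : ℝ) + 1 : ℝ)) ^ p • (g (1 - 1 / (z + ((j : ℝ) + 1 : ℝ))) - g 1) +
          ((z + ((j : ℝ) + 1 : ℝ)) ^ p - z ^ p) • g 1 := by
        rw [smul_sub, sub_smul]; abel
      have e2 : -1 - τ = p.re - 1 := by rw [hτ]; ring
      rw [e1, e2, add_mul]
      refine (norm_add_le _ _).trans (add_le_add (hHsub z hz j hj) ?_)
      rw [norm_smul]
      have h1 := norm_cpow_add_sub_le (p := p) (z := z) (by linarith)
        (mem_slitPlane_of_mem_rightDomain hR0.le hz) (t := (j : ℝ) + 1) (ρ := ‖z‖ / 2)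
        (by positivity) (by positivity) fun θ hθ => half z hz θ hθ.1 (hθ.2.trans hj')
      calc _ ≤ (‖p‖ * e * (‖z‖ / 2) ^ (p.re - 1) * N) * ‖g 1‖ := by
            refine mul_le_mul_of_nonneg_right (h1.trans ?_) (norm_nonneg _)
            gcongr
        _ = _ := by
            rw [show ‖z‖ / 2 = 1 / 2 * ‖z‖ by ring, Real.mul_rpow (by norm_num) hz0.le]; ring
  obtain ⟨K, hK0, hK⟩ := hGb
  obtain ⟨F, hFd, hFsum, hFb⟩ := exists_sum_translates hR1 hN hGd hK0 hτ0 hK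
  refine ⟨R, hR1, F, hFd, fun x hx => ?_, hFb⟩
  have hx0 : 0 < x := hR0.trans hx
  have hGx : ∀ y : ℝ, R < y → ψ y = G y + ψ (y + N) := by
    intro y hy
    have h1 := hψ.iterate (hR0.trans hy) N
    rw [hA, one_apply_eq_self] at h1
    rw [h1]
    congr 1
    refine Finset.sum_congr rfl fun j _ => ?_
    have hm := add_mem_rightDomain (ofReal_mem_rightDomain hy) (t := (j : ℝ) + 1) (by positivity)
    have h2 := hgψ (1 - 1 / (y + (j + 1))) (by
      have := hball _ hm
      push_cast at this ⊢; exact this)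
    rw [← h2, hH]
    push_cast; rfl
  have hiter : ∀ m : ℕ, ψ x = ∑ i ∈ Finset.range m, G ((x : ℂ) + ((i * N : ℕ) : ℝ)) +
      ψ (x + (m * N : ℕ)) := by
    intro m
    induction m with
    | zero => simp
    | succ k ih =>
      rw [Finset.sum_range_succ, add_assoc]
      refine ih.trans ?_
      congr 1
      rw [hGx (x + (k * N : ℕ)) (by
        have : (0 : ℝ) ≤ ((k * N : ℕ) : ℝ) := Nat.cast_nonneg _
        linarith)]
      push_cast
      congr 2; ring
  have hlim1 := (hFsum x (ofReal_mem_rightDomain hx)).tendsto_sum_nat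
  have hlim2 : Tendsto (fun m : ℕ => ψ (x + (m * N : ℕ))) atTop (𝓝 0) := by
    refine h0.comp (tendsto_atTop_add_const_left _ x ?_)
    exact tendsto_natCast_atTop_atTop.comp (tendsto_id.atTop_mul_const' hN)
  have hlim3 := hlim1.add hlim2
  rw [add_zero] at hlim3
  exact tendsto_nhds_unique hlim3 (by simp only [← hiter]; exact tendsto_const_nhds)

/-- The inversion `φ(x) = x^p ψ(1/x)` exchanges the roles of `A` and `B`. -/
lemma IsThreeTerm.inversion {p : ℂ} {A B : V →L[ℂ] V} {ψ : ℝ → V} (hψ : IsThreeTerm p A B ψ) :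
    IsThreeTerm p B A fun x => (x : ℂ) ^ p • ψ (1 / x) := by
  intro x hx
  have hx1 : 0 < x + 1 := by linarith
  have h := hψ (1 / x) (by positivity)
  have e1 : 1 / x + 1 = (x + 1) / x := by field_simp; ring
  have e2 : 1 / x / ((x + 1) / x) = 1 / (x + 1) := by field_simp
  have e3 : 1 / (x / (x + 1)) = (x + 1) / x := by field_simp
  have e4 : ((1 / x : ℝ) : ℂ) + 1 = (((x + 1) / x : ℝ) : ℂ) := by rw [← e1]; push_cast; rfl
  rw [e4, e1, e2] at h
  have e5 : (x : ℂ) ^ p * (((x + 1) / x : ℝ) : ℂ) ^ p = ((x + 1 : ℝ) : ℂ) ^ p := by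
    rw [← Complex.mul_cpow_ofReal_nonneg hx.le (by positivity), ← Complex.ofReal_mul]
    congr 2; field_simp
  have e6 : ((x + 1 : ℝ) : ℂ) ^ p * ((x / (x + 1) : ℝ) : ℂ) ^ p = (x : ℂ) ^ p := by
    rw [← Complex.mul_cpow_ofReal_nonneg hx1.le (by positivity), ← Complex.ofReal_mul]
    congr 2; field_simp
  have e7 : (x : ℂ) + 1 = ((x + 1 : ℝ) : ℂ) := by push_cast; rfl
  simp only [e3, e7]
  rw [h, smul_add, smul_smul, e5, map_smul, map_smul, smul_smul, e6, add_comm]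

end ThreeTerm

/-! ### Extension to a cone around the positive real axis -/

/-- The open cone `|Im z| < κ Re z` around the positive real axis. -/
def openCone (κ : ℝ) : Set ℂ := {z | 0 < z.re} ∩ {z | |z.im| < κ * z.re}

lemma isOpen_openCone (κ : ℝ) : IsOpen (openCone κ) :=
  (isOpen_lt continuous_const Complex.continuous_re).inter
    (isOpen_lt (continuous_abs.comp Complex.continuous_im)
      (continuous_const.mul Complex.continuous_re))

lemma convex_openCone (κ : ℝ) : Convex ℝ (openCone κ) := by
  refine (convex_halfSpace_re_gt 0).inter ?_
  intro z hz w hw a b ha hb hab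
  simp only [Set.mem_ofPred_eq, Complex.add_im, Complex.add_re, Complex.real_smul,
    Complex.mul_im, Complex.mul_re, Complex.ofReal_re, Complex.ofReal_im, zero_mul, add_zero,
    sub_zero] at hz hw ⊢
  rw [abs_lt] at hz hw ⊢
  rcases ha.eq_or_lt with rfl | ha'
  · obtain rfl : b = 1 := by linarith
    simpa using hw
  · constructor <;> nlinarith

lemma ofReal_mem_openCone {κ x : ℝ} (hκ : 0 < κ) (hx : 0 < x) : (x : ℂ) ∈ openCone κ := by
  refine ⟨by simpa using hx, ?_⟩
  simp only [Set.mem_ofPred_eq, Complex.ofReal_im, abs_zero, Complex.ofReal_re]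
  positivity

lemma div_add_one_re {z : ℂ} :
    (z / (z + 1)).re = (Complex.normSq z + z.re) / Complex.normSq (z + 1) := by
  rw [Complex.div_re, Complex.normSq_apply z]
  simp only [Complex.add_re, Complex.one_re, Complex.add_im, Complex.one_im]
  ring

lemma div_add_one_im {z : ℂ} : (z / (z + 1)).im = z.im / Complex.normSq (z + 1) := by
  rw [Complex.div_im]
  simp only [Complex.add_re, Complex.one_re, Complex.add_im, Complex.one_im]
  ring

lemma add_one_mem_slitPlane {z : ℂ} (hz : z ∈ Complex.slitPlane) : z + 1 ∈ Complex.slitPlane := by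
  simpa using add_ofReal_mem_slitPlane hz zero_le_one

lemma normSq_add_one_pos {z : ℂ} (hz : z ∈ Complex.slitPlane) : 0 < Complex.normSq (z + 1) :=
  Complex.normSq_pos.2 (Complex.slitPlane_ne_zero (add_one_mem_slitPlane hz))

lemma openCone_subset_slitPlane (κ : ℝ) : openCone κ ⊆ Complex.slitPlane := fun _ hz =>
  Complex.mem_slitPlane_iff.2 (Or.inl hz.1)

lemma add_one_mem_openCone {κ : ℝ} (hκ : 0 < κ) {z : ℂ} (hz : z ∈ openCone κ) :
    z + 1 ∈ openCone κ := by
  obtain ⟨h1, h2⟩ := hz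
  simp only [Set.mem_ofPred_eq] at h1 h2
  refine ⟨?_, ?_⟩
  · simp only [Set.mem_ofPred_eq, Complex.add_re, Complex.one_re]; linarith
  · simp only [Set.mem_ofPred_eq, Complex.add_re, Complex.one_re, Complex.add_im, Complex.one_im,
      add_zero]
    linarith

lemma div_add_one_mem_openCone {κ : ℝ} (hκ : 0 < κ) {z : ℂ} (hz : z ∈ openCone κ) :
    z / (z + 1) ∈ openCone κ := by
  have h := normSq_add_one_pos (openCone_subset_slitPlane κ hz)
  obtain ⟨h1, h2⟩ := hz
  simp only [Set.mem_ofPred_eq] at h1 h2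
  have h3 := Complex.normSq_nonneg z
  refine ⟨?_, ?_⟩
  · simp only [Set.mem_ofPred_eq, div_add_one_re]
    exact div_pos (by linarith) h
  · simp only [Set.mem_ofPred_eq, div_add_one_re, div_add_one_im, abs_div, abs_of_pos h]
    rw [← mul_div_assoc, div_lt_div_iff_of_pos_right h]
    nlinarith

section Extension

variable {V : Type*} [NormedAddCommGroup V] [NormedSpace ℂ V]

/-- A real analytic function on `(0, ∞)` that extends holomorphically to a right half plane and,
after inversion, to another one, extends to a cone. All the local extensions live on discs centred
at positive reals, and these are compatible by the identity theorem. -/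
lemma exists_extension_cone [CompleteSpace V] {p : ℂ} {ψ : ℝ → V}
    (hψ : AnalyticOnNhd ℝ ψ (Set.Ioi 0)) {R R' : ℝ} (hR : 1 ≤ R) (hR' : 1 ≤ R') {F F' : ℂ → V}
    (hF : DifferentiableOn ℂ F (rightDomain R)) (hFψ : ∀ x : ℝ, R < x → F x = ψ x)
    (hF' : DifferentiableOn ℂ F' (rightDomain R'))
    (hFψ' : ∀ x : ℝ, R' < x → F' x = (x : ℂ) ^ p • ψ (1 / x)) :
    ∃ κ > 0, ∃ G : ℂ → V, DifferentiableOn ℂ G (openCone κ) ∧ ∀ x : ℝ, 0 < x → G x = ψ x := by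
  let ι := {i : ℝ × ℝ × (ℂ → V) //
    DifferentiableOn ℂ i.2.2 (Metric.ball (i.1 : ℂ) i.2.1) ∧
      ∀ x : ℝ, (x : ℂ) ∈ Metric.ball (i.1 : ℂ) i.2.1 → i.2.2 x = ψ x}
  let U : ι → Set ℂ := fun i => Metric.ball (i.1.1 : ℂ) i.1.2.1
  have hUo : ∀ i, IsOpen (U i) := fun i => Metric.isOpen_ball
  have hre : ∀ (c r : ℝ) (z : ℂ), z ∈ Metric.ball (c : ℂ) r →
      (z.re : ℂ) ∈ Metric.ball (c : ℂ) r := by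
    intro c r z hz
    rw [Metric.mem_ball, dist_eq_norm] at hz ⊢
    refine lt_of_le_of_lt ?_ hz
    have := Complex.abs_re_le_norm (z - c)
    rwa [Complex.sub_re, Complex.ofReal_re, ← Real.norm_eq_abs, ← Complex.norm_real,
      Complex.ofReal_sub] at this
  obtain ⟨G, hGd, hG⟩ := exists_glue U hUo (fun i => i.1.2.2) (fun i => i.2.1) (by
    intro i j z hz
    exact eqOn_of_eq_ofReal ((hUo i).inter (hUo j))
      ((convex_ball _ _).inter (convex_ball _ _)).isPreconnected
      (i.2.1.mono Set.inter_subset_left) (j.2.1.mono Set.inter_subset_right)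
      (x₀ := z.re) ⟨hre _ _ _ hz.1, hre _ _ _ hz.2⟩
      (fun x hx => (i.2.2 x hx.1).trans (j.2.2 x hx.2).symm) hz)
  -- discs exhausting the half plane `Re z > R`
  have far : ∀ z : ℂ, R < z.re → z ∈ ⋃ i, U i := by
    intro z hz
    have hz' : 0 < z.re - R := by linarith
    set c : ℝ := R + (z.re ^ 2 + z.im ^ 2) / (2 * (z.re - R)) with hc
    have hcpos : 0 ≤ (z.re ^ 2 + z.im ^ 2) / (2 * (z.re - R)) := by positivity
    have hsub : Metric.ball (c : ℂ) (c - R) ⊆ {w : ℂ | R < w.re} := by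
      intro w hw
      rw [Metric.mem_ball, dist_eq_norm, norm_sub_rev] at hw
      have := (Complex.re_le_norm ((c : ℂ) - w)).trans_lt hw
      simp only [Complex.sub_re, Complex.ofReal_re] at this
      simp only [Set.mem_ofPred_eq]; linarith
    refine Set.mem_iUnion.2 ⟨⟨(c, c - R, F), hF.mono fun w hw => Or.inl (hsub hw),
      fun x hx => hFψ x (by simpa using hsub hx)⟩, ?_⟩
    change z ∈ Metric.ball (c : ℂ) (c - R)
    rw [Metric.mem_ball, dist_eq_norm]
    refine lt_of_pow_lt_pow_left₀ 2 (by linarith) ?_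
    rw [Complex.sq_norm, Complex.normSq_apply]
    simp only [Complex.sub_re, Complex.ofReal_re, Complex.sub_im, Complex.ofReal_im, sub_zero]
    have e : (c - R) * (2 * (z.re - R)) = z.re ^ 2 + z.im ^ 2 := by rw [hc]; field_simp; ring
    nlinarith
  -- the disc with the diameter `(0, 1 / R')`
  have close : ∀ z : ℂ, Complex.normSq z * R' < z.re → z ∈ ⋃ i, U i := by
    intro z hz
    have hball : ∀ w : ℂ, w ∈ Metric.ball ((1 / (2 * R') : ℝ) : ℂ) (1 / (2 * R')) ↔
        Complex.normSq w * R' < w.re := by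
      intro w
      have h1 : (0 : ℝ) ≤ 1 / (2 * R') := by positivity
      rw [Metric.mem_ball, dist_eq_norm, ← sq_lt_sq₀ (norm_nonneg _) h1, Complex.sq_norm,
        Complex.normSq_apply, Complex.normSq_apply]
      simp only [Complex.sub_re, Complex.ofReal_re, Complex.sub_im, Complex.ofReal_im, sub_zero]
      have e : (w.re - 1 / (2 * R')) * (w.re - 1 / (2 * R')) + w.im * w.im =
        w.re * w.re + w.im * w.im - w.re / R' + (1 / (2 * R')) ^ 2 := by field_simp; ring
      rw [e, ← lt_div_iff₀ (by linarith : 0 < R')]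
      constructor <;> intro h <;> linarith
    have hinv : ∀ w : ℂ, Complex.normSq w * R' < w.re → 1 / w ∈ rightDomain R' := by
      intro w hw
      left
      have hre0 : 0 < w.re := lt_of_le_of_lt (mul_nonneg (Complex.normSq_nonneg w) (by linarith)) hw
      have hn : 0 < Complex.normSq w := Complex.normSq_pos.2 fun h => by simp [h] at hre0
      simp only [Set.mem_ofPred_eq, one_div, Complex.inv_re]
      rw [lt_div_iff₀ hn]; linarith
    have hpos : ∀ w : ℂ, Complex.normSq w * R' < w.re → w ∈ Complex.slitPlane := fun w hw =>
      Complex.mem_slitPlane_iff.2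
        (Or.inl (lt_of_le_of_lt (mul_nonneg (Complex.normSq_nonneg w) (by linarith)) hw))
    refine Set.mem_iUnion.2 ⟨⟨(1 / (2 * R'), 1 / (2 * R'), fun w => w ^ p • F' (1 / w)), ?_, ?_⟩,
      (hball z).2 hz⟩
    · refine DifferentiableOn.smul (fun w hw => ?_) (hF'.comp (fun w hw => ?_)
        fun w hw => hinv w ((hball w).1 hw))
      · exact (differentiableAt_id.cpow_const
          (hpos w ((hball w).1 hw))).differentiableWithinAt
      · exact ((differentiableAt_const _).div differentiableAt_id
          (Complex.slitPlane_ne_zero (hpos w ((hball w).1 hw)))).differentiableWithinAt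
    · intro x hx
      have hx1 := hinv _ ((hball x).1 hx)
      have hx0 : 0 < x := Complex.ofReal_mem_slitPlane.1 (hpos _ ((hball x).1 hx))
      have e : 1 / (x : ℂ) = ((1 / x : ℝ) : ℂ) := by push_cast; rfl
      have hlt : R' < 1 / x := by
        rw [e] at hx1
        rcases hx1 with h | h
        · simpa using h
        · simp only [Set.mem_ofPred_eq, Complex.ofReal_im, abs_zero] at h; linarith
      simp only [e, hFψ' _ hlt, one_div_one_div, smul_smul]
      rw [← Complex.mul_cpow_ofReal_nonneg hx0.le (by positivity), ← Complex.ofReal_mul,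
        mul_one_div_cancel hx0.ne', Complex.ofReal_one, Complex.one_cpow, one_smul]
  have pos : ∀ x : ℝ, 0 < x → (x : ℂ) ∈ ⋃ i, U i := by
    intro x hx
    obtain ⟨r, hr, g, hg, hgψ⟩ := exists_holomorphic_extension (hψ x hx)
    exact Set.mem_iUnion.2 ⟨⟨(x, r, g), hg, hgψ⟩, Metric.mem_ball_self hr⟩
  have hcomp : IsCompact ((fun x : ℝ => (x : ℂ)) '' Set.Icc (1 / (2 * R')) R) :=
    isCompact_Icc.image Complex.continuous_ofReal
  obtain ⟨δ, hδ, hδU⟩ := hcomp.exists_thickening_subset_open (isOpen_iUnion hUo) (by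
    rintro _ ⟨x, hx, rfl⟩
    exact pos x (lt_of_lt_of_le (by positivity) hx.1))
  refine ⟨min 1 (δ / R), by positivity, G, hGd.mono ?_, fun x hx => ?_⟩
  · intro z hz
    obtain ⟨h1, h2⟩ := hz
    simp only [Set.mem_ofPred_eq] at h1 h2
    by_cases hzR : R < z.re
    · exact far z hzR
    push Not at hzR
    by_cases hzR' : z.re < 1 / (2 * R')
    · refine close z ?_
      have h3 : |z.im| < z.re := h2.trans_le (by nlinarith [min_le_left 1 (δ / R)])
      rw [Complex.normSq_apply]
      have h4 : z.im * z.im ≤ z.re * z.re := by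
        rw [abs_lt] at h3; nlinarith
      rw [lt_div_iff₀ (by positivity)] at hzR'
      have : z.re * (z.re * (2 * R')) < z.re * 1 := by gcongr
      nlinarith
    · push Not at hzR'
      refine hδU (Metric.mem_thickening_iff.2 ⟨_, ⟨z.re, ⟨hzR', hzR⟩, rfl⟩, ?_⟩)
      have e : z - (z.re : ℂ) = z.im * Complex.I := by
        apply Complex.ext <;> simp
      rw [dist_eq_norm, e, norm_mul, Complex.norm_I, mul_one, Complex.norm_real,
        Real.norm_eq_abs]
      refine h2.trans_le ?_
      calc min 1 (δ / R) * z.re ≤ δ / R * R := by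
            gcongr; exact min_le_right _ _
        _ = δ := by field_simp
  · obtain ⟨i, hi⟩ := Set.mem_iUnion.1 (pos x hx)
    rw [hG i hi, i.2.2 x hi]

/-! ### Extension to the slit plane -/

/-- The sets on which the three-term equation, iterated `n` times, only involves values on a
cone. -/
def slitExhaustion (κ : ℝ) : ℕ → Set ℂ
  | 0 => openCone κ
  | n + 1 => Complex.slitPlane ∩
      ({z | z + 1 ∈ slitExhaustion κ n} ∩ {z | z / (z + 1) ∈ slitExhaustion κ n})

/-- The `n`-fold iteration of the three-term equation. -/
noncomputable def threeTermIterate (p : ℂ) (A B : V →L[ℂ] V) (G : ℂ → V) : ℕ → ℂ → V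
  | 0 => G
  | n + 1 => fun z => A (threeTermIterate p A B G n (z + 1)) +
      (z + 1) ^ p • B (threeTermIterate p A B G n (z / (z + 1)))

lemma slitExhaustion_subset_slitPlane (κ : ℝ) (n : ℕ) :
    slitExhaustion κ n ⊆ Complex.slitPlane := by
  cases n with
  | zero => exact openCone_subset_slitPlane κ
  | succ n => exact Set.inter_subset_left

lemma differentiableOn_div_add_one :
    DifferentiableOn ℂ (fun z : ℂ => z / (z + 1)) Complex.slitPlane := by
  intro z hz
  have h := Complex.slitPlane_ne_zero (add_one_mem_slitPlane hz)
  fun_prop (disch := exact h)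

lemma isOpen_slitExhaustion (κ : ℝ) (n : ℕ) : IsOpen (slitExhaustion κ n) := by
  induction n with
  | zero => exact isOpen_openCone κ
  | succ n ih =>
    have h1 : IsOpen {z : ℂ | z + 1 ∈ slitExhaustion κ n} :=
      ih.preimage (continuous_id.add continuous_const)
    have h2 := differentiableOn_div_add_one.continuousOn.isOpen_inter_preimage
      Complex.isOpen_slitPlane ih
    have e : slitExhaustion κ (n + 1) = (Complex.slitPlane ∩
        (fun z : ℂ => z / (z + 1)) ⁻¹' slitExhaustion κ n) ∩
        {z : ℂ | z + 1 ∈ slitExhaustion κ n} := by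
      rw [slitExhaustion, Set.inter_assoc]
      congr 1
      exact Set.inter_comm _ _
    rw [e]
    exact h2.inter h1

lemma slitExhaustion_subset_succ {κ : ℝ} (hκ : 0 < κ) (n : ℕ) :
    slitExhaustion κ n ⊆ slitExhaustion κ (n + 1) := by
  induction n with
  | zero =>
    exact fun z hz => ⟨openCone_subset_slitPlane κ hz, add_one_mem_openCone hκ hz,
      div_add_one_mem_openCone hκ hz⟩
  | succ n ih => exact fun z hz => ⟨hz.1, ih hz.2.1, ih hz.2.2⟩

/-- Words of length `n` in `z ↦ z + 1` and `z ↦ z / (z + 1)` move `z` into a given cone for large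
`n`: under each step `Re z / |Im z|` grows by `1 / |Im z|` or by `‖z‖ ^ 2 / |Im z|`, and the lower
bound `μ |Im z| ≤ ‖c z + d‖ ^ 2` for all `c, d ∈ ℕ`, not both `0`, persists. -/
lemma mem_slitExhaustion_of_le {κ μ : ℝ} (hκ : 0 < κ) (n : ℕ) :
    ∀ z : ℂ, z.im ≠ 0 →
      (∀ c d : ℕ, c ≠ 0 ∨ d ≠ 0 → μ * |z.im| ≤ Complex.normSq (c * z + d)) →
      1 / κ < z.re / |z.im| + n * μ → z ∈ slitExhaustion κ n := by
  induction n with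
  | zero =>
    intro z hz _ h
    have h0 : 0 < |z.im| := abs_pos.2 hz
    rw [Nat.cast_zero, zero_mul, add_zero, div_lt_div_iff₀ hκ h0] at h
    refine ⟨?_, by simp only [Set.mem_ofPred_eq]; linarith⟩
    simp only [Set.mem_ofPred_eq]
    by_contra hcon
    push Not at hcon
    nlinarith
  | succ n ih =>
    intro z hz hE h
    have h0 : 0 < |z.im| := abs_pos.2 hz
    have hs : z ∈ Complex.slitPlane := Complex.mem_slitPlane_iff.2 (Or.inr hz)
    have hn := normSq_add_one_pos hs
    have hE1 : μ ≤ 1 / |z.im| := by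
      rw [le_div_iff₀ h0]; simpa using hE 0 1 (Or.inr one_ne_zero)
    have hE2 : μ ≤ Complex.normSq z / |z.im| := by
      rw [le_div_iff₀ h0]; simpa using hE 1 0 (Or.inl one_ne_zero)
    push_cast at h
    refine ⟨hs, ih _ (by simpa using hz) ?_ ?_, ih _ ?_ ?_ ?_⟩
    · intro c d hcd
      have := hE c (c + d) (by omega)
      have e : (c : ℂ) * (z + 1) + d = c * z + ((c + d : ℕ) : ℂ) := by push_cast; ring
      rw [e]; simpa using this
    · simp only [Complex.add_re, Complex.one_re, Complex.add_im, Complex.one_im, add_zero,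
        add_div]
      linarith
    · rw [div_add_one_im]; exact div_ne_zero hz hn.ne'
    · intro c d hcd
      have := hE (c + d) d (by omega)
      have hne := Complex.slitPlane_ne_zero (add_one_mem_slitPlane hs)
      have e : (c : ℂ) * (z / (z + 1)) + d = (((c + d : ℕ) : ℂ) * z + d) / (z + 1) := by
        push_cast; field_simp; ring
      rw [e, map_div₀, div_add_one_im, abs_div, abs_of_pos hn, ← mul_div_assoc]
      gcongr
    · rw [div_add_one_im, div_add_one_re, abs_div, abs_of_pos hn, div_div_div_cancel_right₀ hn.ne',
        add_div]
      linarith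

lemma iUnion_slitExhaustion {κ : ℝ} (hκ : 0 < κ) :
    ⋃ n, slitExhaustion κ n = Complex.slitPlane := by
  refine Set.Subset.antisymm
    (Set.iUnion_subset fun n => slitExhaustion_subset_slitPlane κ n) fun z hz => ?_
  by_cases h : z.im = 0
  · have hre : 0 < z.re := by
      rcases Complex.mem_slitPlane_iff.1 hz with h1 | h1
      · exact h1
      · exact absurd h h1
    refine Set.mem_iUnion.2 ⟨0, hre, ?_⟩
    simp only [Set.mem_ofPred_eq, h, abs_zero]; positivity
  · have h0 : 0 < |z.im| := abs_pos.2 h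
    set μ := min |z.im| (1 / |z.im|) with hμ
    have hμ0 : 0 < μ := lt_min h0 (by positivity)
    obtain ⟨n, hn⟩ := exists_nat_gt ((1 / κ - z.re / |z.im|) / μ)
    refine Set.mem_iUnion.2 ⟨n, mem_slitExhaustion_of_le (μ := μ) hκ n z h ?_ ?_⟩
    · intro c d hcd
      rw [Complex.normSq_apply]
      simp only [Complex.add_re, Complex.mul_re, Complex.natCast_re, Complex.natCast_im, zero_mul,
        sub_zero, Complex.add_im, Complex.mul_im, add_zero]
      rcases Nat.eq_zero_or_pos c with rfl | hc
      · have hd : (1 : ℝ) ≤ d := by exact_mod_cast Nat.one_le_iff_ne_zero.2 (by tauto)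
        have : μ * |z.im| ≤ 1 / |z.im| * |z.im| := by gcongr; exact min_le_right _ _
        rw [one_div_mul_cancel h0.ne'] at this
        simp only [Nat.cast_zero, zero_mul, zero_add, mul_zero, add_zero]
        nlinarith
      · have hc' : (1 : ℝ) ≤ c := by exact_mod_cast hc
        have h1 : μ * |z.im| ≤ |z.im| * |z.im| := by gcongr; exact min_le_left _ _
        rw [abs_mul_abs_self] at h1
        have h2 : z.im * z.im ≤ (c * z.im) * (c * z.im) := by
          have : (0 : ℝ) ≤ (c * c - 1) * (z.im * z.im) :=
            mul_nonneg (by nlinarith) (mul_self_nonneg _)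
          nlinarith
        nlinarith [mul_self_nonneg ((c : ℝ) * z.re + d)]
    · rw [div_lt_iff₀ hμ0] at hn; linarith

/-- A solution of the three-term equation on the positive reals that extends to a cone extends to
the slit plane, and the equation persists. -/
lemma exists_extension_slitPlane [CompleteSpace V] {p : ℂ} {A B : V →L[ℂ] V} {ψ : ℝ → V}
    (hψ : IsThreeTerm p A B ψ) {κ : ℝ} (hκ : 0 < κ) {G : ℂ → V}
    (hG : DifferentiableOn ℂ G (openCone κ)) (hGψ : ∀ x : ℝ, 0 < x → G x = ψ x) :
    ∃ Ψ : ℂ → V, DifferentiableOn ℂ Ψ Complex.slitPlane ∧ (∀ x : ℝ, 0 < x → Ψ x = ψ x) ∧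
      ∀ z ∈ Complex.slitPlane,
        Ψ z = A (Ψ (z + 1)) + (z + 1) ^ p • B (Ψ (z / (z + 1))) := by
  set f := threeTermIterate p A B G with hf
  have step : ∀ (U W : Set ℂ), U ⊆ Complex.slitPlane → (∀ z ∈ U, z + 1 ∈ W) →
      (∀ z ∈ U, z / (z + 1) ∈ W) → ∀ g : ℂ → V, DifferentiableOn ℂ g W →
      DifferentiableOn ℂ (fun z => A (g (z + 1)) + (z + 1) ^ p • B (g (z / (z + 1)))) U := by
    intro U W hU h1 h2 g hg
    refine (A.differentiable.comp_differentiableOn (hg.comp (by fun_prop) h1)).add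
      (DifferentiableOn.smul (fun z hz => ?_) (B.differentiable.comp_differentiableOn
        (hg.comp (differentiableOn_div_add_one.mono hU) h2)))
    exact ((differentiableAt_id.add_const 1).cpow_const
      (add_one_mem_slitPlane (hU hz))).differentiableWithinAt
  have hfd : ∀ n, DifferentiableOn ℂ (f n) (slitExhaustion κ n) := by
    intro n
    induction n with
    | zero => exact hG
    | succ n ih =>
      exact step _ _ (slitExhaustion_subset_slitPlane κ (n + 1)) (fun z hz => hz.2.1)
        (fun z hz => hz.2.2) _ ih
  have hsucc : ∀ n, Set.EqOn (f (n + 1)) (f n) (slitExhaustion κ n) := by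
    intro n
    induction n with
    | zero =>
      refine eqOn_of_eq_ofReal (isOpen_openCone κ) (convex_openCone κ).isPreconnected
        (step _ _ (openCone_subset_slitPlane κ) (fun z hz => add_one_mem_openCone hκ hz)
          (fun z hz => div_add_one_mem_openCone hκ hz) _ hG) hG (x₀ := 1)
        (ofReal_mem_openCone hκ one_pos) fun x hx => ?_
      have hx0 : 0 < x := by simpa using hx.1
      have e1 : (x : ℂ) + 1 = ((x + 1 : ℝ) : ℂ) := by push_cast; rfl
      have e2 : (x : ℂ) / ((x + 1 : ℝ) : ℂ) = ((x / (x + 1) : ℝ) : ℂ) := by push_cast; rfl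
      have h := hψ x hx0
      rw [e1] at h
      change A (G (x + 1)) + ((x : ℂ) + 1) ^ p • B (G (x / (x + 1))) = G x
      rw [e1, e2, hGψ _ (by positivity), hGψ _ (by positivity), hGψ _ hx0, h]
    | succ n ih =>
      intro z hz
      change A (f (n + 1) (z + 1)) + (z + 1) ^ p • B (f (n + 1) (z / (z + 1))) =
        A (f n (z + 1)) + (z + 1) ^ p • B (f n (z / (z + 1)))
      rw [ih hz.2.1, ih hz.2.2]
  have hmono : Monotone (slitExhaustion κ) := monotone_nat_of_le_succ fun n =>
    slitExhaustion_subset_succ hκ n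
  have hle : ∀ m n, m ≤ n → Set.EqOn (f n) (f m) (slitExhaustion κ m) := by
    intro m n hmn
    induction n, hmn using Nat.le_induction with
    | base => exact fun _ _ => rfl
    | succ n hmn ih => exact fun z hz => (hsucc n (hmono hmn hz)).trans (ih hz)
  obtain ⟨Ψ, hΨd, hΨ⟩ := exists_glue (slitExhaustion κ) (isOpen_slitExhaustion κ) f hfd (by
    intro i j z hz
    rcases le_total i j with h | h
    · exact (hle i j h hz.1).symm
    · exact hle j i h hz.2)
  rw [iUnion_slitExhaustion hκ] at hΨd
  refine ⟨Ψ, hΨd, fun x hx => ?_, fun z hz => ?_⟩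
  · rw [hΨ 0 (ofReal_mem_openCone hκ hx)]; exact hGψ x hx
  · rw [← iUnion_slitExhaustion hκ] at hz
    obtain ⟨n, hn⟩ := Set.mem_iUnion.1 hz
    have hn1 := slitExhaustion_subset_succ hκ n hn
    rw [hΨ (n + 1) hn1, hΨ n hn1.2.1, hΨ n hn1.2.2]
    rfl

end Extension

/-! ### Bounds in sectors -/

lemma mem_rightDomain_of_sector {c R : ℝ} (hc0 : 0 ≤ c) (hc : c < 1) (hR : 1 ≤ R) {z : ℂ}
    (hz : -c * ‖z‖ ≤ z.re) (hzR : 2 * R / (1 - c) ≤ ‖z‖) : z ∈ rightDomain R := by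
  by_contra hcon
  simp only [rightDomain, Set.mem_union, Set.mem_ofPred_eq, not_or, not_lt] at hcon
  obtain ⟨h1, h2⟩ := hcon
  have hc1 : 0 < 1 - c := by linarith
  have e : ‖z‖ ^ 2 = z.re ^ 2 + z.im ^ 2 := by
    rw [Complex.sq_norm, Complex.normSq_apply]; ring
  have h3 : z.im ^ 2 ≤ R ^ 2 := sq_le_sq' (by linarith [neg_abs_le z.im])
    (by linarith [le_abs_self z.im])
  have h4 : 2 * R ≤ (1 - c) * ‖z‖ := by rw [div_le_iff₀ hc1] at hzR; linarith
  have h0 := norm_nonneg z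
  have h5 : 2 * R ≤ ‖z‖ := by nlinarith
  have h6 : 4 * R ^ 2 ≤ (1 - c) * ‖z‖ ^ 2 := by nlinarith
  rcases le_or_gt 0 z.re with h | h
  · have : z.re ^ 2 ≤ R ^ 2 := by nlinarith
    nlinarith
  · have h7 : z.re ^ 2 ≤ c ^ 2 * ‖z‖ ^ 2 := by nlinarith
    have h8 : c ^ 2 * ‖z‖ ^ 2 ≤ c * ‖z‖ ^ 2 := by
      gcongr; nlinarith
    nlinarith

lemma sector_subset_slitPlane {c : ℝ} (hc : c < 1) {z : ℂ} (hz0 : z ≠ 0)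
    (hz : -c * ‖z‖ ≤ z.re) : z ∈ Complex.slitPlane := by
  rw [Complex.mem_slitPlane_iff]
  by_contra hcon
  push Not at hcon
  have h0 : 0 < ‖z‖ := norm_pos_iff.2 hz0
  have e : ‖z‖ = |z.re| := (Complex.abs_re_eq_norm.2 hcon.2).symm
  rw [abs_of_nonpos hcon.1] at e
  nlinarith

section Bounds

variable {V : Type*} [NormedAddCommGroup V] [NormedSpace ℂ V]

/-- The bounds at infinity and, after inversion, at `0` together bound `Ψ` in every sector; in
between a sector is compact. -/
lemma sector_bound [CompleteSpace V] {p : ℂ} {Ψ F F' : ℂ → V}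
    (hΨ : DifferentiableOn ℂ Ψ Complex.slitPlane) {R R' : ℝ} (hR : 1 ≤ R) (hR' : 1 ≤ R')
    (hF : DifferentiableOn ℂ F (rightDomain R)) (hFΨ : ∀ x : ℝ, R < x → F x = Ψ x)
    (hF' : DifferentiableOn ℂ F' (rightDomain R'))
    (hFΨ' : ∀ x : ℝ, R' < x → F' x = (x : ℂ) ^ p • Ψ (1 / x)) {τ C : ℝ} (hC0 : 0 < C)
    (hCτ : C ≤ τ)
    (hFb : ∀ c, 0 ≤ c → c < 1 → ∃ K, ∀ z ∈ rightDomain R, -c * ‖z‖ ≤ z.re →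
        ‖F z‖ ≤ K * ‖z‖ ^ (-τ))
    (hFb' : ∀ c, 0 ≤ c → c < 1 → ∃ K, ∀ z ∈ rightDomain R', -c * ‖z‖ ≤ z.re →
        ‖F' z‖ ≤ K * ‖z‖ ^ p.re) {c : ℝ} (hc0 : 0 ≤ c) (hc : c < 1) :
    ∃ K, 0 ≤ K ∧ ∀ z ∈ Complex.slitPlane, -c * ‖z‖ ≤ z.re →
      ‖Ψ z‖ ≤ K * min 1 (‖z‖ ^ (-C)) := by
  have hreal : ∀ (R : ℝ), 1 ≤ R → ∀ x : ℝ, (x : ℂ) ∈ rightDomain R → R < x := by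
    intro R hR x hx
    rcases hx with h | h
    · simpa using h
    · simp only [Set.mem_ofPred_eq, Complex.ofReal_im, abs_zero] at h; linarith
  have hinv : ∀ w ∈ Complex.slitPlane, 1 / w ∈ Complex.slitPlane := by
    intro w hw
    have hn : 0 < Complex.normSq w := Complex.normSq_pos.2 (Complex.slitPlane_ne_zero hw)
    rw [one_div, Complex.mem_slitPlane_iff, Complex.inv_re, Complex.inv_im]
    exact (Complex.mem_slitPlane_iff.1 hw).imp (fun h => div_pos h hn)
      fun h => div_ne_zero (neg_ne_zero.2 h) hn.ne'
  have h1 : Set.EqOn F Ψ (rightDomain R) := by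
    refine eqOn_of_eq_ofReal (isOpen_rightDomain R) (isPreconnected_rightDomain R) hF
      (hΨ.mono fun z hz => mem_slitPlane_of_mem_rightDomain (by linarith) hz) (x₀ := R + 1)
      (ofReal_mem_rightDomain (by linarith)) fun x hx => hFΨ x (hreal R hR x hx)
  have h2 : Set.EqOn F' (fun w => w ^ p • Ψ (1 / w)) (rightDomain R') := by
    have hs : ∀ z ∈ rightDomain R', z ∈ Complex.slitPlane := fun z hz =>
      mem_slitPlane_of_mem_rightDomain (by linarith) hz
    refine eqOn_of_eq_ofReal (isOpen_rightDomain R') (isPreconnected_rightDomain R') hF'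
      (DifferentiableOn.smul (fun z hz => ?_) (hΨ.comp (fun z hz => ?_)
        fun z hz => hinv z (hs z hz))) (x₀ := R' + 1)
      (ofReal_mem_rightDomain (by linarith)) fun x hx => hFΨ' x (hreal R' hR' x hx)
    · exact (differentiableAt_id.cpow_const (hs z hz)).differentiableWithinAt
    · exact ((differentiableAt_const _).div differentiableAt_id
        (Complex.slitPlane_ne_zero (hs z hz))).differentiableWithinAt
  obtain ⟨K₁, hK₁⟩ := hFb c hc0 hc
  obtain ⟨K₂, hK₂⟩ := hFb' c hc0 hc
  have hc1 : 0 < 1 - c := by linarith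
  have hc2 : (1 - c)⁻¹ ≥ 1 := (one_le_inv₀ hc1).2 (by linarith)
  set ρ := 2 * R / (1 - c) with hρ
  set ρ' := 2 * R' / (1 - c) with hρ'
  have hρ1 : 1 ≤ ρ := by rw [hρ, div_eq_mul_inv]; nlinarith
  have hρ1' : 1 ≤ ρ' := by rw [hρ', div_eq_mul_inv]; nlinarith
  have hρ0' : 0 < ρ' := by linarith
  have hcomp : IsCompact {z : ℂ | 1 / ρ' ≤ ‖z‖ ∧ ‖z‖ ≤ ρ ∧ -c * ‖z‖ ≤ z.re} := by
    refine Metric.isCompact_of_isClosed_isBounded ?_ ?_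
    · refine (isClosed_le continuous_const continuous_norm).inter
        ((isClosed_le continuous_norm continuous_const).inter
          (isClosed_le (by fun_prop) Complex.continuous_re))
    · exact (Metric.isBounded_closedBall (x := (0 : ℂ)) (r := ρ)).subset fun z hz => by
        simpa using hz.2.1
  obtain ⟨K₃, hK₃⟩ := hcomp.exists_bound_of_continuousOn (f := Ψ)
    (hΨ.continuousOn.mono fun z hz => by
      refine sector_subset_slitPlane hc (fun h => ?_) hz.2.2
      have := hz.1
      rw [h, norm_zero] at this
      have : 0 < 1 / ρ' := by positivity
      linarith)
  set e := Real.exp (Real.pi * |p.im|) with he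
  have he0 : 0 < e := Real.exp_pos _
  refine ⟨|K₁| + e * |K₂| + |K₃| * ρ ^ C, by positivity, fun z hz hzc => ?_⟩
  have hz0 : 0 < ‖z‖ := norm_pos_iff.2 (Complex.slitPlane_ne_zero hz)
  have hp1 : 0 ≤ |K₁| := abs_nonneg _
  have hp2 : 0 ≤ e * |K₂| := by positivity
  have hp3 : 0 ≤ |K₃| * ρ ^ C := by positivity
  have hmin0 : 0 ≤ min 1 (‖z‖ ^ (-C)) := by positivity
  rcases le_or_gt ρ ‖z‖ with h | h
  · have hm := mem_rightDomain_of_sector hc0 hc hR hzc h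
    have hz1 : 1 ≤ ‖z‖ := hρ1.trans h
    rw [min_eq_right (Real.rpow_le_one_of_one_le_of_nonpos hz1 (by linarith)), ← h1 hm]
    calc ‖F z‖ ≤ K₁ * ‖z‖ ^ (-τ) := hK₁ z hm hzc
      _ ≤ |K₁| * ‖z‖ ^ (-C) := by
          gcongr
          exact le_abs_self _
      _ ≤ _ := by gcongr; linarith
  rcases le_or_gt ‖z‖ (1 / ρ') with h' | h'
  · have hw : 1 / z ∈ Complex.slitPlane := hinv z hz
    have hnw : ‖1 / z‖ = 1 / ‖z‖ := by rw [norm_div, norm_one]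
    have hwc : -c * ‖1 / z‖ ≤ (1 / z).re := by
      rw [hnw, one_div z, Complex.inv_re, Complex.normSq_eq_norm_sq, le_div_iff₀ (by positivity)]
      calc -c * (1 / ‖z‖) * ‖z‖ ^ 2 = -c * ‖z‖ := by field_simp
        _ ≤ z.re := hzc
    have hwρ : ρ' ≤ ‖1 / z‖ := by
      rw [hnw, le_div_iff₀ hz0]
      rw [le_div_iff₀ hρ0'] at h'; linarith
    have hm := mem_rightDomain_of_sector hc0 hc hR' hwc hwρ
    have hz1 : ‖z‖ ≤ 1 := h'.trans (by rw [div_le_one hρ0']; exact hρ1')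
    rw [min_eq_left (Real.one_le_rpow_of_pos_of_le_one_of_nonpos hz0 hz1 (by linarith)), mul_one]
    have e1 : Ψ z = z ^ p • F' (1 / z) := by
      rw [h2 hm]
      simp only [one_div, inv_inv, smul_smul]
      rw [Complex.inv_cpow _ _ (Complex.slitPlane_arg_ne_pi hz), mul_inv_cancel₀, one_smul]
      exact (Complex.cpow_ne_zero_iff.2 (Or.inl (Complex.slitPlane_ne_zero hz)))
    calc ‖Ψ z‖ ≤ (e * ‖z‖ ^ p.re) * (|K₂| * ‖1 / z‖ ^ p.re) := by
          rw [e1, norm_smul]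
          gcongr
          · exact norm_cpow_le_rpow p
          · exact (hK₂ _ hm hwc).trans (by gcongr; exact le_abs_self _)
      _ = e * |K₂| * (‖z‖ * ‖1 / z‖) ^ p.re := by
          rw [Real.mul_rpow hz0.le (norm_nonneg _)]; ring
      _ = e * |K₂| := by rw [hnw, mul_one_div_cancel hz0.ne', Real.one_rpow, mul_one]
      _ ≤ _ := by linarith
  · have hm : ρ ^ (-C) ≤ min 1 (‖z‖ ^ (-C)) :=
      le_min (Real.rpow_le_one_of_one_le_of_nonpos hρ1 (by linarith))
        (Real.rpow_le_rpow_of_nonpos hz0 h.le (by linarith))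
    have hρC : ρ ^ C * ρ ^ (-C) = 1 := by
      rw [← Real.rpow_add (by linarith)]; simp
    calc ‖Ψ z‖ ≤ K₃ := hK₃ z ⟨h'.le, h.le, hzc⟩
      _ ≤ |K₃| := le_abs_self _
      _ = |K₃| * ρ ^ C * ρ ^ (-C) := by rw [mul_assoc, hρC, mul_one]
      _ ≤ |K₃| * ρ ^ C * min 1 (‖z‖ ^ (-C)) := by gcongr
      _ ≤ _ := by gcongr; linarith

/-- A real analytic solution of the three-term equation with the growth of a real period function
extends to the slit plane, with the growth of a period function. -/
lemma IsThreeTerm.exists_extension [CompleteSpace V] {p : ℂ} (hp : p.re < 0) {A B : V →L[ℂ] V}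
    {N : ℕ} (hN : 1 ≤ N) (hA : A ^ N = 1) (hB : B ^ N = 1) {ψ : ℝ → V}
    (hψ : IsThreeTerm p A B ψ) (han : AnalyticOnNhd ℝ ψ (Set.Ioi 0))
    (hinf : Tendsto ψ atTop (𝓝 0))
    (hzero₁ : Tendsto (fun x : ℝ => x ^ (-1 : ℝ) * ‖ψ (1 / x)‖) atTop (𝓝 0))
    (hzero₂ : Tendsto (fun x : ℝ => x ^ p.re * ‖ψ (1 / x)‖) atTop (𝓝 0)) :
    ∃ Ψ : ℂ → V, DifferentiableOn ℂ Ψ Complex.slitPlane ∧ (∀ x : ℝ, 0 < x → Ψ x = ψ x) ∧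
      (∀ z ∈ Complex.slitPlane,
        Ψ z = A (Ψ (z + 1)) + (z + 1) ^ p • B (Ψ (z / (z + 1)))) ∧
      ∃ C, 0 < C ∧ C < -p.re ∧ ∀ c, 0 ≤ c → c < 1 → ∃ K, 0 ≤ K ∧ ∀ z ∈ Complex.slitPlane,
        -c * ‖z‖ ≤ z.re → ‖Ψ z‖ ≤ K * min 1 (‖z‖ ^ (-C)) := by
  have hQ : ∀ A : V →L[ℂ] V, A ^ N = 1 → ∀ v,
      (∑ j ∈ Finset.range N, A ^ j) (A v) = (∑ j ∈ Finset.range N, A ^ j) v := by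
    intro A hA v
    have h := geom_sum_mul A N
    rw [hA, sub_self] at h
    have h2 := congrArg (fun f : V →L[ℂ] V => f v) h
    simpa [sub_eq_zero, mul_sub] using h2
  set φ : ℝ → V := fun x => (x : ℂ) ^ p • ψ (1 / x) with hφ
  have hφ3 : IsThreeTerm p B A φ := hψ.inversion
  have hφnorm : ∀ᶠ x : ℝ in atTop, ‖φ x‖ = x ^ p.re * ‖ψ (1 / x)‖ := by
    filter_upwards [eventually_gt_atTop 0] with x hx
    rw [hφ, norm_smul, Complex.norm_cpow_eq_rpow_re_of_pos hx]
  have hψ1 : AnalyticAt ℝ ψ 1 := han 1 (by simp)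
  have hφ1 : AnalyticAt ℝ φ 1 := by
    refine AnalyticAt.smul ?_ ?_
    · have h1 : AnalyticAt ℂ (fun z : ℂ => z ^ p) ((1 : ℝ) : ℂ) :=
        analyticAt_id.cpow analyticAt_const (Complex.ofReal_mem_slitPlane.2 one_pos)
      exact (h1.restrictScalars (𝕜 := ℝ)).comp (Complex.ofRealCLM.analyticAt 1)
    · have h2 : AnalyticAt ℝ (fun x : ℝ => 1 / x) 1 :=
        analyticAt_const.div analyticAt_id one_ne_zero
      have h3 : AnalyticAt ℝ ψ (1 / 1) := by simpa using hψ1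
      exact h3.comp h2
  have hφinf : Tendsto φ atTop (𝓝 0) :=
    tendsto_zero_iff_norm_tendsto_zero.2 (hzero₂.congr' (hφnorm.mono fun _ h => h.symm))
  have hφv : (∑ j ∈ Finset.range N, B ^ j) (A (φ 1)) = 0 := by
    refine coinvariant_part_eq_zero hp (hQ B hB) hφ3 hφ1.differentiableAt (hzero₁.congr' ?_)
    filter_upwards [hφnorm, eventually_gt_atTop 0] with x hx hx0
    rw [hx, ← mul_assoc, ← Real.rpow_add hx0]
    congr 2; ring
  obtain ⟨R', hR', F', hF', hFφ, hFb'⟩ := exists_extension_at_infty hp hN hB hφ3 hφ1 hφinf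
    (τ := -p.re) (by linarith) (Or.inr ⟨rfl, hφv⟩)
  simp only [neg_neg] at hFb'
  -- for `-Re p ≤ 1` the decay of `ψ` gives the vanishing, otherwise it is not needed
  obtain ⟨τ, C, hC0, hCτ, hCp, hτ⟩ : ∃ τ C, 0 < C ∧ C ≤ τ ∧ C < -p.re ∧ (τ = -p.re - 1 ∨
      τ = -p.re ∧ (∑ j ∈ Finset.range N, A ^ j) (B (ψ 1)) = 0) := by
    rcases lt_or_ge 1 (-p.re) with h | h
    · exact ⟨-p.re - 1, -p.re - 1, by linarith, le_rfl, by linarith, Or.inl rfl⟩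
    · refine ⟨-p.re, -p.re / 2, by linarith, by linarith, by linarith, Or.inr ⟨rfl, ?_⟩⟩
      refine coinvariant_part_eq_zero hp (hQ A hA) hψ hψ1.differentiableAt ?_
      refine squeeze_zero' ?_ ?_ (tendsto_zero_iff_norm_tendsto_zero.1 hinf)
      · filter_upwards [eventually_gt_atTop 0] with x hx using by positivity
      · filter_upwards [eventually_ge_atTop 1] with x hx
        exact mul_le_of_le_one_left (norm_nonneg _)
          (Real.rpow_le_one_of_one_le_of_nonpos hx (by linarith))
  obtain ⟨R, hR, F, hF, hFψ, hFb⟩ := exists_extension_at_infty hp hN hA hψ hψ1 hinf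
    (hC0.trans_le hCτ) hτ
  obtain ⟨κ, hκ, G, hG, hGψ⟩ := exists_extension_cone han hR hR' hF hFψ hF' hFφ
  obtain ⟨Ψ, hΨ, hΨψ, hΨ3⟩ := exists_extension_slitPlane hψ hκ hG hGψ
  refine ⟨Ψ, hΨ, hΨψ, hΨ3, C, hC0, hCp, fun c hc0 hc => ?_⟩
  refine sector_bound hΨ hR hR' hF (fun x hx => ?_) hF' (fun x hx => ?_) hC0 hCτ hFb hFb' hc0 hc
  · rw [hFψ x hx, hΨψ x (by linarith)]
  · have hx0 : 0 < x := by linarith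
    have := hΨψ (1 / x) (by positivity)
    push_cast at this
    rw [hFφ x hx, this]

end Bounds

/-- A bound in the sectors `Re z ≥ -c ‖z‖`, `c < 1`, is one in the sectors `|arg z| ≤ π - δ`. -/
lemma hasSlitPlaneBound_of_sector {V : Type*} [NormedAddCommGroup V] {C : ℝ} {Ψ : ℂ → V}
    (h : ∀ c, 0 ≤ c → c < 1 → ∃ K, 0 ≤ K ∧ ∀ z ∈ Complex.slitPlane,
      -c * ‖z‖ ≤ z.re → ‖Ψ z‖ ≤ K * min 1 (‖z‖ ^ (-C))) : HasSlitPlaneBound C Ψ := by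
  intro δ hδ
  rcases le_or_gt δ Real.pi with hπ | hπ
  · have hcos : Real.cos δ < 1 := by
      have := Real.cos_lt_cos_of_nonneg_of_le_pi le_rfl hπ hδ
      simpa using this
    obtain ⟨K, -, hK⟩ := h (max 0 (Real.cos δ)) (le_max_left _ _) (max_lt one_pos hcos)
    refine ⟨K, fun z hz hzδ => hK z hz ?_⟩
    have h1 : -Real.cos δ ≤ Real.cos z.arg := by
      rw [← Real.cos_abs z.arg, ← Real.cos_pi_sub]
      exact Real.cos_le_cos_of_nonneg_of_le_pi (abs_nonneg _) (by linarith) hzδ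
    rw [← Complex.norm_mul_cos_arg z, mul_comm]
    refine mul_le_mul_of_nonneg_left ?_ (norm_nonneg _)
    linarith [le_max_right 0 (Real.cos δ)]
  · refine ⟨0, fun z _ hz => ?_⟩
    linarith [abs_nonneg z.arg]

/-! ### The modular group -/

lemma genS_relation : genS * genT⁻¹ * (genS * genT⁻¹) = genT * genS := by
  have h : matS * matT⁻¹ * (matS * matT⁻¹) = matT * matS := by
    apply Subtype.ext
    simp only [Matrix.SpecialLinearGroup.coe_mul, Matrix.SpecialLinearGroup.coe_inv]
    simp [matS, matT, Matrix.adjugate_fin_two]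
  exact congrArg toMod h

lemma genT_inv_mul_eq : genT⁻¹ * (genS * genT⁻¹) = genS * genT * genS⁻¹ := by
  have h : matT⁻¹ * (matS * matT⁻¹) = matS * matT * matS⁻¹ := by
    apply Subtype.ext
    simp only [Matrix.SpecialLinearGroup.coe_mul, Matrix.SpecialLinearGroup.coe_inv]
    simp [matS, matT, Matrix.adjugate_fin_two]
  exact congrArg toMod h

lemma coe_matT_pow (n : ℕ) :
    ((matT ^ n : Matrix.SpecialLinearGroup (Fin 2) ℤ) : Matrix (Fin 2) (Fin 2) ℤ) =
      !![1, (n : ℤ); 0, 1] := by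
  induction n with
  | zero => simp [Matrix.one_fin_two]
  | succ n ih =>
    rw [pow_succ, Matrix.SpecialLinearGroup.coe_mul, ih]
    simp [matT, add_comm]

lemma isParabolicElt_genT_pow {n : ℕ} (hn : n ≠ 0) : IsParabolicElt (genT ^ n) := by
  refine ⟨matT ^ n, rfl, ?_, ?_⟩
  · rintro ⟨a, ha⟩
    rw [coe_matT_pow] at ha
    have := congrFun (congrFun ha 0) 1
    simp only [Matrix.scalar_apply, ne_eq, zero_ne_one, not_false_eq_true,
      Matrix.diagonal_apply_ne] at this
    simp at this
    exact hn (by exact_mod_cast this.symm)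
  · rw [coe_matT_pow, Matrix.discr_fin_two]
    simp [Matrix.trace_fin_two, Matrix.det_fin_two]

/-- The cusp at infinity: some positive power of `T` lies in `Γ_par`. -/
lemma exists_genT_pow_mem_parabolicSubgroup (Γ : Subgroup ModGroup) [Γ.Normal] [Γ.FiniteIndex] :
    ∃ N : ℕ, 1 ≤ N ∧ genT ^ N ∈ parabolicSubgroup Γ :=
  ⟨Γ.index, Nat.one_le_iff_ne_zero.2 Subgroup.FiniteIndex.index_ne_zero,
    Subgroup.subset_closure ⟨Γ.pow_index_mem genT,
      isParabolicElt_genT_pow Subgroup.FiniteIndex.index_ne_zero⟩⟩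

section Rep

variable {V : Type*} [NormedAddCommGroup V] [NormedSpace ℂ V]

/-- The Lewis equation, solved for `ψ(z)`. -/
lemma lewis_iff (η : Representation ℂ ModGroup V) (a b c : V) (k : ℂ) :
    η genT a = b + k • η (genS * genT⁻¹) c ↔
      a = η genT⁻¹ b + k • η (genT⁻¹ * (genS * genT⁻¹)) c := by
  constructor
  · intro h
    have := congrArg (η genT⁻¹) h
    rwa [η.inv_self_apply, map_add, map_smul, ← Module.End.mul_apply, ← map_mul] at this
  · intro h
    rw [h, map_add, map_smul, η.self_inv_apply, ← Module.End.mul_apply, ← map_mul,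
      mul_inv_cancel_left]

/-- The action of a group element, as a continuous linear map. -/
noncomputable def repCLM [FiniteDimensional ℂ V] (η : Representation ℂ ModGroup V)
    (γ : ModGroup) : V →L[ℂ] V :=
  LinearMap.toContinuousLinearMap (η γ)

lemma repCLM_pow_eq_one [FiniteDimensional ℂ V] (η : Representation ℂ ModGroup V)
    {γ : ModGroup} {n : ℕ} (h : ∀ v, η (γ ^ n) v = v) : repCLM η γ ^ n = 1 := by
  have key : ∀ n v, (repCLM η γ ^ n) v = η (γ ^ n) v := by
    intro n
    induction n with
    | zero => simp
    | succ n ih => intro v; rw [pow_succ', pow_succ', mul_apply_eq_comp, ih, map_mul]; rfl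
  ext v
  rw [key, h, one_apply_eq_self]

/-! ### The asymptotic formula -/

lemma div_cpow_of_im_ne_zero {z : ℂ} (hz : z.im ≠ 0) (p : ℂ) :
    (z + 1) ^ p * (z / (z + 1)) ^ p = z ^ p := by
  have hs : z ∈ Complex.slitPlane := Complex.mem_slitPlane_iff.2 (Or.inr hz)
  have hs1 := add_one_mem_slitPlane hs
  have h0 := Complex.slitPlane_ne_zero hs
  have h1 := Complex.slitPlane_ne_zero hs1
  have hpi := Complex.slitPlane_arg_ne_pi hs1
  have hlog : Complex.log (z / (z + 1)) = Complex.log z - Complex.log (z + 1) := by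
    rw [div_eq_mul_inv, Complex.log_mul h0 (inv_ne_zero h1), Complex.log_inv _ hpi, sub_eq_add_neg]
    rw [Complex.arg_inv, if_neg hpi]
    have e : (z + 1).im = z.im := by simp
    have b1 := Complex.arg_le_pi z
    have b2 := Complex.neg_pi_lt_arg z
    have b3 := Complex.arg_le_pi (z + 1)
    have b4 := Complex.neg_pi_lt_arg (z + 1)
    rcases lt_or_gt_of_ne hz with h | h
    · have c1 := Complex.arg_neg_iff.2 h
      have c2 := Complex.arg_neg_iff.2 (e ▸ h : (z + 1).im < 0)
      constructor <;> linarith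
    · have c1 := Complex.arg_nonneg_iff.2 h.le
      have c2 := Complex.arg_nonneg_iff.2 (e ▸ h.le : 0 ≤ (z + 1).im)
      have c3 : (z + 1).arg < Real.pi := lt_of_le_of_ne b3 hpi
      constructor <;> linarith
  rw [Complex.cpow_def_of_ne_zero h1, Complex.cpow_def_of_ne_zero (div_ne_zero h0 h1),
    Complex.cpow_def_of_ne_zero h0, ← Complex.exp_add, hlog]
  congr 1; ring

/-- For solutions of the Lewis equation `ψ(z) + z^(-2ν-1) η(S) ψ(-1/z)` is equivariant under
translations. -/
lemma symmetrized_add_one {ν : ℂ} {η : Representation ℂ ModGroup V} {Ψ : ℂ → V}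
    (h : ∀ z ∈ Complex.slitPlane,
      η genT (Ψ z) =
        Ψ (z + 1) + (z + 1) ^ (-2 * ν - 1) • η (genS * genT⁻¹) (Ψ (z / (z + 1))))
    {z : ℂ} (hz : z.im ≠ 0) :
    symmetrized ν η Ψ (z + 1) = η genT (symmetrized ν η Ψ z) := by
  have hs : z ∈ Complex.slitPlane := Complex.mem_slitPlane_iff.2 (Or.inr hz)
  have h0 := Complex.slitPlane_ne_zero hs
  have h1 := Complex.slitPlane_ne_zero (add_one_mem_slitPlane hs)
  have hn := normSq_add_one_pos hs
  have hw : -1 / (z + 1) ∈ Complex.slitPlane := by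
    refine Complex.mem_slitPlane_iff.2 (Or.inr ?_)
    rw [neg_div, Complex.neg_im, one_div, Complex.inv_im]
    exact neg_ne_zero.2 (div_ne_zero (neg_ne_zero.2 (by simpa using hz)) hn.ne')
  have e1 : -1 / (z + 1) + 1 = z / (z + 1) := by field_simp; ring
  have e2 : -1 / (z + 1) / (z / (z + 1)) = -1 / z := by field_simp
  have hL1 := h z hs
  have hL2 := h _ hw
  rw [e1, e2] at hL2
  have hL3 := congrArg (η (genS * genT⁻¹)) hL2
  rw [← Module.End.mul_apply, ← map_mul, inv_mul_cancel_right, map_add, map_smul,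
    ← Module.End.mul_apply, ← map_mul, genS_relation] at hL3
  unfold symmetrized
  rw [hL3, smul_add, smul_smul, div_cpow_of_im_ne_zero hz, ← add_assoc, ← hL1, map_add, map_smul,
    map_mul, Module.End.mul_apply]

/-- Both limits in the asymptotic formula vanish for solutions of the Lewis equation with the
growth of a period function: the symmetrized function is periodic, so it suffices to let `z` go
to infinity in a vertical strip. -/
lemma tendsto_symmetrized [FiniteDimensional ℂ V] {ν : ℂ} (hν : (-2 * ν - 1).re < 0)
    {η : Representation ℂ ModGroup V} {N : ℕ} (hN : 1 ≤ N) (hT : ∀ v, η (genT ^ N) v = v)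
    {Ψ : ℂ → V}
    (h : ∀ z ∈ Complex.slitPlane,
      η genT (Ψ z) =
        Ψ (z + 1) + (z + 1) ^ (-2 * ν - 1) • η (genS * genT⁻¹) (Ψ (z / (z + 1))))
    {C : ℝ} (hC : 0 < C)
    (hΨ : ∀ c, 0 ≤ c → c < 1 → ∃ K, 0 ≤ K ∧ ∀ z ∈ Complex.slitPlane,
      -c * ‖z‖ ≤ z.re → ‖Ψ z‖ ≤ K * min 1 (‖z‖ ^ (-C))) :
    Tendsto (symmetrized ν η Ψ) (comap (fun z : ℂ => |z.im|) atTop) (𝓝 0) := by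
  set p := -2 * ν - 1 with hp
  set f := symmetrized ν η Ψ with hf
  have hnat : ∀ (n : ℕ) (z : ℂ), z.im ≠ 0 → f (z + n) = η (genT ^ n) (f z) := by
    intro n
    induction n with
    | zero => intro z _; simp
    | succ n ih =>
      intro z hz
      have := symmetrized_add_one h (z := z + n) (by simpa using hz)
      rw [Nat.cast_succ, ← add_assoc, hf, this, ← hf, ih z hz, pow_succ', map_mul,
        Module.End.mul_apply]
  have hTm : ∀ (m : ℕ) v, η (genT ^ (N * m)) v = v := by
    intro m
    induction m with
    | zero => simp
    | succ m ih => intro v; rw [mul_add_one, pow_add, map_mul, Module.End.mul_apply, hT, ih]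
  have hper : ∀ (m : ℕ) (z : ℂ), z.im ≠ 0 → f (z + (N * m : ℕ)) = f z := fun m z hz => by
    rw [hnat _ z hz, hTm]
  have hperZ : ∀ (k : ℤ) (z : ℂ), z.im ≠ 0 → f (z - N * k) = f z := by
    intro k z hz
    obtain ⟨m, rfl | rfl⟩ := k.eq_nat_or_neg
    · have := hper m (z - N * m) (by simpa using hz)
      push_cast at this ⊢
      rw [← this, sub_add_cancel]
    · have := hper m z hz
      push_cast at this ⊢
      rw [← this]; congr 1; ring
  obtain ⟨K, hK0, hK⟩ := hΨ (1 / 2) (by norm_num) (by norm_num)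
  set e := Real.exp (Real.pi * |p.im|) with he
  set s := ‖repCLM η genS‖ with hs
  have hbound : ∀ z : ℂ, 2 * N ≤ |z.im| →
      ‖f z‖ ≤ K * |z.im| ^ (-C) + e * (s * K) * |z.im| ^ p.re := by
    intro z hz
    have hN' : (1 : ℝ) ≤ N := by exact_mod_cast hN
    have hN0 : (0 : ℝ) < N := by linarith
    have hz0 : z.im ≠ 0 := abs_pos.1 (by linarith)
    have hfl0 := Int.floor_le (z.re / N)
    have hfl1 := Int.lt_floor_add_one (z.re / N)
    set k := ⌊z.re / N⌋ with hk
    rw [le_div_iff₀ hN0] at hfl0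
    rw [div_lt_iff₀ hN0] at hfl1
    rw [← hperZ k z hz0]
    set w : ℂ := z - N * k with hw
    have hwim : w.im = z.im := by simp [hw]
    have hwre : w.re = z.re - N * k := by simp [hw]
    have hre0 : 0 ≤ w.re := by rw [hwre]; linarith
    have hre1 : w.re ≤ N := by rw [hwre]; linarith
    have hnorm : |z.im| ≤ ‖w‖ := hwim ▸ Complex.abs_im_le_norm w
    have him0 : 0 < |z.im| := abs_pos.2 hz0
    have hnorm0 : 0 < ‖w‖ := him0.trans_le hnorm
    have hws : w ∈ Complex.slitPlane := Complex.mem_slitPlane_iff.2 (Or.inr (hwim ▸ hz0))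
    have hnsq : Complex.normSq w = ‖w‖ ^ 2 := Complex.normSq_eq_norm_sq w
    have hvs : -1 / w ∈ Complex.slitPlane := by
      refine Complex.mem_slitPlane_iff.2 (Or.inr ?_)
      rw [neg_div, Complex.neg_im, one_div, Complex.inv_im, hnsq, hwim]
      exact neg_ne_zero.2 (div_ne_zero (neg_ne_zero.2 hz0) (by positivity))
    have hvc : -(1 / 2) * ‖-1 / w‖ ≤ (-1 / w).re := by
      rw [neg_div, norm_neg, norm_div, norm_one, Complex.neg_re, one_div w, Complex.inv_re, hnsq,
        neg_mul, neg_le_neg_iff, div_le_iff₀ (by positivity)]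
      calc w.re ≤ 1 / 2 * ‖w‖ := by linarith
        _ = 1 / 2 * (1 / ‖w‖) * ‖w‖ ^ 2 := by field_simp
    have b1 : ‖Ψ w‖ ≤ K * |z.im| ^ (-C) := by
      refine (hK w hws (by nlinarith)).trans (mul_le_mul_of_nonneg_left ?_ hK0)
      exact (min_le_right _ _).trans (Real.rpow_le_rpow_of_nonpos him0 hnorm (by linarith))
    have b2 : ‖Ψ (-1 / w)‖ ≤ K :=
      (hK _ hvs hvc).trans (mul_le_of_le_one_right hK0 (min_le_left _ _))
    have b3 : ‖w ^ p‖ ≤ e * |z.im| ^ p.re := by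
      refine (norm_cpow_le_rpow p).trans (mul_le_mul_of_nonneg_left ?_ (Real.exp_pos _).le)
      exact Real.rpow_le_rpow_of_nonpos him0 hnorm hν.le
    have b4 : ‖η genS (Ψ (-1 / w))‖ ≤ s * K :=
      ((repCLM η genS).le_opNorm _).trans (by gcongr)
    calc ‖f w‖ ≤ ‖Ψ w‖ + ‖w ^ p‖ * ‖η genS (Ψ (-1 / w))‖ := by
          rw [← norm_smul]; exact norm_add_le _ _
      _ ≤ K * |z.im| ^ (-C) + (e * |z.im| ^ p.re) * (s * K) := by gcongr
      _ = _ := by ring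
  have ht : Tendsto (fun z : ℂ => |z.im|) (comap (fun z : ℂ => |z.im|) atTop) atTop :=
    tendsto_comap
  have hl1 := ((tendsto_rpow_neg_atTop hC).comp ht).const_mul K
  have hl2 := ((tendsto_rpow_neg_atTop (neg_pos.2 hν)).comp ht).const_mul (e * (s * K))
  simp only [neg_neg, mul_zero] at hl1 hl2
  refine squeeze_zero_norm' ?_ (by simpa using hl1.add hl2)
  filter_upwards [ht.eventually_ge_atTop (2 * N : ℝ)] with z hz using hbound z hz

end Rep

/-! ### Comparison of the two spaces -/

/-- A growth condition at `0`, read at infinity after the inversion `x ↦ 1 / x`. -/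
lemma tendsto_rpow_mul_norm_inv {V : Type*} [NormedAddCommGroup V] {ψ : ℝ → V} {k : ℝ}
    (h : ψ =o[𝓝[>] 0] fun x : ℝ => x ^ (-1 + k)) {s : ℝ} (hs : s ≤ -1 + k) :
    Tendsto (fun x : ℝ => x ^ s * ‖ψ (1 / x)‖) atTop (𝓝 0) := by
  have h1 := h.comp_tendsto tendsto_inv_atTop_nhdsGT_zero
  have h2 := h1.norm_left.tendsto_div_nhds_zero
  refine squeeze_zero' ?_ ?_ h2
  · filter_upwards [eventually_gt_atTop 0] with x hx using by positivity
  · filter_upwards [eventually_ge_atTop 1] with x hx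
    have hx0 : 0 < x := by linarith
    simp only [Function.comp, one_div]
    rw [Real.inv_rpow hx0.le, div_inv_eq_mul, mul_comm]
    gcongr

section Comparison

variable {V : Type*} [NormedAddCommGroup V] [NormedSpace ℂ V]

/-- The restriction of a period function to the positive reals is a real period function. -/
lemma IsLewisFunction.isRealPeriodFunction [CompleteSpace V] {ν : ℂ} (hν : -(1 / 2 : ℝ) < ν.re)
    {η : Representation ℂ ModGroup V} {Ψ : ℂ → V} (h : IsLewisFunction ν η Ψ) {C : ℝ} (hC : 0 < C)
    (hΨ : HasSlitPlaneBound C Ψ) : IsRealPeriodFunction ν η fun x : ℝ => Ψ x := by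
  obtain ⟨K, hK⟩ := hΨ Real.pi Real.pi_pos
  have hK' : ∀ x : ℝ, 0 < x → ‖Ψ x‖ ≤ K * min 1 (x ^ (-C)) := by
    intro x hx
    have := hK x (Complex.ofReal_mem_slitPlane.2 hx) (by
      rw [Complex.arg_ofReal_of_nonneg hx.le]; simp)
    rwa [Complex.norm_real, Real.norm_of_nonneg hx.le] at this
  have hmin : ∀ x : ℝ, 0 < x → 0 < min 1 (x ^ (-C)) := fun x hx => by positivity
  have hK0 : 0 ≤ K := by
    have := (norm_nonneg _).trans (hK' 1 one_pos)
    exact nonneg_of_mul_nonneg_left this (hmin 1 one_pos)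
  refine ⟨fun x hx => ?_, fun x hx => ?_, ?_, ?_⟩
  · have h1 := h.holomorphic.analyticOnNhd Complex.isOpen_slitPlane (x : ℂ)
      (Complex.ofReal_mem_slitPlane.2 hx)
    exact (h1.restrictScalars (𝕜 := ℝ)).comp (Complex.ofRealCLM.analyticAt x)
  · have := h.lewis x (Complex.ofReal_mem_slitPlane.2 hx)
    push_cast
    exact this
  · have hO : (fun x : ℝ => Ψ x) =O[𝓝[>] 0] fun _ : ℝ => (1 : ℝ) := by
      refine IsBigO.of_bound K ?_
      filter_upwards [self_mem_nhdsWithin] with x hx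
      rw [norm_one]
      exact (hK' x hx).trans (mul_le_mul_of_nonneg_left (min_le_left _ _) hK0)
    refine hO.trans_isLittleO ?_
    rw [isLittleO_const_left]
    right
    refine tendsto_norm_atTop_atTop.comp (tendsto_rpow_neg_nhdsGT_zero ?_)
    have : kappa ν < 1 := by
      rw [kappa, neg_lt]
      exact lt_min (by norm_num) (by linarith)
    linarith
  · rw [isLittleO_one_iff]
    have hl := (tendsto_rpow_neg_atTop hC).const_mul K
    rw [mul_zero] at hl
    refine squeeze_zero_norm' ?_ hl
    filter_upwards [eventually_gt_atTop 0] with x hx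
    exact (hK' x hx).trans (mul_le_mul_of_nonneg_left (min_le_right _ _) hK0)

/-- A real period function is the restriction of a period function. -/
lemma IsRealPeriodFunction.exists_extension [FiniteDimensional ℂ V] {ν : ℂ}
    (hν : -(1 / 2 : ℝ) < ν.re) {η : Representation ℂ ModGroup V} {N : ℕ} (hN : 1 ≤ N)
    (hT : ∀ v, η (genT ^ N) v = v) {ψ : ℝ → V} (h : IsRealPeriodFunction ν η ψ) :
    ∃ Ψ : ℂ → V, IsLewisFunction ν η Ψ ∧
      (∃ C, 0 < C ∧ C < 2 * ν.re + 1 ∧ HasSlitPlaneBound C Ψ) ∧ ∀ x : ℝ, 0 < x → Ψ x = ψ x := by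
  have : CompleteSpace V := FiniteDimensional.complete ℂ V
  have hpre : (-2 * ν - 1).re = -2 * ν.re - 1 := by simp
  have hp : (-2 * ν - 1).re < 0 := by rw [hpre]; linarith
  have hA : repCLM η genT⁻¹ ^ N = 1 := by
    refine repCLM_pow_eq_one η fun v => ?_
    conv_lhs => rw [← hT v]
    rw [inv_pow, η.inv_self_apply]
  have hB : repCLM η (genT⁻¹ * (genS * genT⁻¹)) ^ N = 1 := by
    refine repCLM_pow_eq_one η fun v => ?_
    rw [genT_inv_mul_eq, conj_pow, map_mul, map_mul, Module.End.mul_apply, Module.End.mul_apply,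
      hT, η.self_inv_apply]
  have h3 : IsThreeTerm (-2 * ν - 1) (repCLM η genT⁻¹) (repCLM η (genT⁻¹ * (genS * genT⁻¹))) ψ :=
    fun x hx => (lewis_iff η _ _ _ _).1 (h.lewis x hx)
  have hk1 : 0 ≤ kappa ν := by rw [kappa, neg_nonneg]; exact min_le_left _ _
  have hk2 : -(2 * ν.re) ≤ kappa ν := by rw [kappa, neg_le_neg_iff]; exact min_le_right _ _
  obtain ⟨Ψ, hΨ, hΨψ, hΨ3, C, hC0, hC, hb⟩ := h3.exists_extension hp hN hA hB h.analytic
    ((isLittleO_one_iff ℝ).1 h.at_infty)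
    (tendsto_rpow_mul_norm_inv h.at_zero (by linarith))
    (tendsto_rpow_mul_norm_inv h.at_zero (by rw [hpre]; linarith))
  have hL : ∀ z ∈ Complex.slitPlane, η genT (Ψ z) =
      Ψ (z + 1) + (z + 1) ^ (-2 * ν - 1) • η (genS * genT⁻¹) (Ψ (z / (z + 1))) :=
    fun z hz => (lewis_iff η _ _ _ _).2 (hΨ3 z hz)
  have ht := tendsto_symmetrized hp hN hT hL hC0 hb
  refine ⟨Ψ, ⟨hΨ, hL, 0, 0, ht.mono_left ?_, ht.mono_left ?_, by simp⟩,
    ⟨C, hC0, by rw [hpre] at hC; linarith, hasSlitPlaneBound_of_sector hb⟩, hΨψ⟩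
  · rw [← tendsto_iff_comap]
    exact tendsto_abs_atTop_atTop.comp tendsto_comap
  · rw [← tendsto_iff_comap]
    exact tendsto_abs_atBot_atTop.comp tendsto_comap

end Comparison

end LewisZagier

theorem mainTheorem2
    (Γ : Subgroup LewisZagier.ModGroup) [Γ.Normal] [Γ.FiniteIndex]
    (hΓ : LewisZagier.IsTorsionFreeSubgroup Γ)
    (q : ℕ)
    {V : Type*} [NormedAddCommGroup V] [NormedSpace ℂ V] [FiniteDimensional ℂ V]
    (η : Representation ℂ LewisZagier.ModGroup V)
    (hpar : LewisZagier.IsTrivialOn (LewisZagier.parabolicSubgroup Γ) η)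
    (huni : LewisZagier.IsUnipotentOn Γ q η)
    (ν : ℂ) (hν : -(1 / 2 : ℝ) < ν.re) :
    LewisZagier.realPeriodSpace ν η =
      LewisZagier.restrictToPosReals '' LewisZagier.periodSpace ν η := by
  have : CompleteSpace V := FiniteDimensional.complete ℂ V
  obtain ⟨N, hN, hNΓ⟩ := LewisZagier.exists_genT_pow_mem_parabolicSubgroup Γ
  ext f
  constructor
  · rintro ⟨ψ, hψ, rfl⟩
    obtain ⟨Ψ, hΨ, hC, hΨψ⟩ := hψ.exists_extension hν hN (hpar _ hNΓ)
    exact ⟨_, ⟨Ψ, hΨ, hC, rfl⟩, funext fun x => hΨψ x x.2⟩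
  · rintro ⟨_, ⟨Ψ, hΨ, ⟨C, hC, -, hb⟩, rfl⟩, rfl⟩
    exact ⟨fun x => Ψ x, hΨ.isRealPeriodFunction hν hC hb, rfl⟩
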